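/- **Setting.** Let $\lambda,\kappa>0$ and $|\theta|<\sqrt{2\kappa}$. On a probability space $(\Omega,\mathcal F,\mathbb P)$ let $B,W$ be independent real Brownian motions, $\nu_0$ a finite random measure and $s_0\ge 0$ a random variable such that $(\nu_0,s_0)$ is independent of $(B,W)$ and $\nu_0$ is supported on $[s_0,\infty)$. Let $(\mathcal F_t)_{t\ge0}$ be the augmented right-continuous filtration generated by $W$, with $\nu_0,s_0$ added to $\mathcal F_0$, and let $\mathcal F_\infty=\bigvee_t\mathcal F_t$. Let $\mathfrak D$ be the set of $(\mathcal F_t)$-adapted processes with nondecreasing right-continuous paths $[0,\infty)\to[0,\infty)$, ordered by $s\le\tilde s$ iff $\mathbb P(s(t)\le\tilde s(t)\ \forall t\ge 0)=1$. For $s\in\mathfrak D$ and $y\in\mathbb R$ put $$X^y_t=y+\sqrt{2\kappa-\theta^2}\,B_t+\theta W_t,\qquad \tau^{y,s}=\inf\{t\ge0: X^y_t\le s(t)\}.$$ A process $s\in\mathfrak D$ is a *solution* if for every $t\ge0$, almost surely, $$s(t)=s_0+\frac1{\lambda\kappa}\int_{[s_0,\infty)}\mathbb P(\tau^{y,s}\le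 t\mid\mathcal F_t)\,\nu_0(\mathrm dy),\tag{MV}$$ and $\Gamma[s]\in\mathfrak D$ denotes the (up to indistinguishability unique) process in $\mathfrak D$ with $\Gamma[s](t)=s_0+\frac1{\lambda\kappa}\int_{[s_0,\infty)}\mathbb P(\tau^{y,s}\le t\mid\mathcal F_\infty)\,\nu_0(\mathrm dy)$ almost surely for every $t\ge0$. In both integrals the conditional probability is taken in its version which is nonincreasing and left-continuous in $y$. The *minimal solution* is the least solution for the order above. **Statement.** The minimal solution $s$ exists, the iterates $\Gamma^n[0]$, $n\ge0$, are well defined in $\mathfrak D$, and: 1. If, almost surely, $\frac1{\lambda\kappa}\nu_0([s_0,s_0+y])<y$ infinitely often as $y\downarrow0$, then $s(0)=s_0$ almost surely. 2. Almost surely, $\Gamma^n[0](t)\to s(t)$ as $n\to\infty$ for every $t>0$ at which $s$ is continuous; under the condition of (1), almost surely also $\Gamma^n[0](0)\to s(0)$. -/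

import Mathlib

open MeasureTheory ProbabilityTheory Filter Topology Set
open scoped NNReal ENNReal

namespace StefanMV

/-- The standing setting: constants `λ, κ > 0` and `|θ| < √(2κ)`; independent Brownian motions `B`
and `W` on a probability space; a finite random measure `ν₀` and a random variable `s₀ ≥ 0` which
are (jointly) independent of `(B, W)`, with `ν₀` supported on `[s₀, ∞)`. -/
structure Setting (Ω : Type*) [MeasurableSpace Ω] (μ : Measure Ω) where
  lam : ℝ
  kap : ℝ
  theta : ℝ
  lam_pos : 0 < lam
  kap_pos : 0 < kap
  abs_theta_lt : |theta| < √(2 * kap)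
  B : ℝ≥0 → Ω → ℝ
  W : ℝ≥0 → Ω → ℝ
  nu0 : Ω → Measure ℝ
  s0 : Ω → ℝ
  measurable_B : ∀ t, Measurable (B t)
  measurable_W : ∀ t, Measurable (W t)
  measurable_nu0 : Measurable nu0
  measurable_s0 : Measurable s0
  isBrownian_B : IsBrownianReal B μ
  isBrownian_W : IsBrownianReal W μ
  indep_B_W : IndepFun (fun ω (t : ℝ≥0) => B t ω) (fun ω (t : ℝ≥0) => W t ω) μ
  indep_init : IndepFun (fun ω => (nu0 ω, s0 ω))
    (fun ω => ((fun t : ℝ≥0 => B t ω), (fun t : ℝ≥0 => W t ω))) μ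
  finite_nu0 : ∀ ω, IsFiniteMeasure (nu0 ω)
  s0_nonneg : ∀ ω, 0 ≤ s0 ω
  support_nu0 : ∀ᵐ ω ∂μ, nu0 ω (Iio (s0 ω)) = 0

/-- The σ-algebra generated by the `μ`-null events. -/
abbrev nullSigma {Ω : Type*} [MeasurableSpace Ω] (μ : Measure Ω) : MeasurableSpace Ω :=
  MeasurableSpace.generateFrom {N | MeasurableSet N ∧ μ N = 0}

/-- `y ↦ p y` is the regular version of `y ↦ P(A y ∣ m)` for a family of events `A y` that decreases
in `y` as the events `{τ^y ≤ t}` below do: each `p y` is a version of `P(A y ∣ m)`, and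
`y ↦ p y ω` is nonincreasing, left-continuous and `[0,1]`-valued for every `ω`. Such a version is
unique up to a null set which does not depend on `y`, so that the integral of `y ↦ p y ω` against a
random measure `ν₀(ω)` is well defined almost surely. -/
structure IsCondProbVersion {Ω : Type*} (m : MeasurableSpace Ω) [mΩ : MeasurableSpace Ω]
    (μ : Measure Ω) (A : ℝ → Set Ω) (p : ℝ → Ω → ℝ) : Prop where
  measurable : ∀ y, Measurable[m] (p y)
  ae_eq : ∀ y, p y =ᵐ[μ] μ⟦A y|m⟧
  mem_Icc : ∀ y ω, p y ω ∈ Icc (0 : ℝ) 1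
  antitone : ∀ ω, Antitone fun y => p y ω
  leftCont : ∀ ω y, ContinuousWithinAt (fun z => p z ω) (Iic y) y

namespace Setting

variable {Ω : Type*} [MeasurableSpace Ω] {μ : Measure Ω} (S : Setting Ω μ)

/-- `σ(ν₀, s₀)`. -/
abbrev initSigma : MeasurableSpace Ω :=
  MeasurableSpace.comap S.nu0 inferInstance ⊔ MeasurableSpace.comap S.s0 inferInstance

theorem initSigma_sup_nullSigma_le : S.initSigma ⊔ nullSigma μ ≤ ‹MeasurableSpace Ω› := by
  refine sup_le (sup_le S.measurable_nu0.comap_le S.measurable_s0.comap_le) ?_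
  exact MeasurableSpace.generateFrom_le fun N hN => hN.1

/-- The augmented right-continuous filtration `(F_t)` generated by `W`, enlarged at time `0` by
`ν₀` and `s₀`. -/
noncomputable def filt : Filtration ℝ≥0 ‹MeasurableSpace Ω› :=
  (Filtration.natural S.W (fun t => (S.measurable_W t).stronglyMeasurable) ⊔
    Filtration.const ℝ≥0 (S.initSigma ⊔ nullSigma μ) S.initSigma_sup_nullSigma_le).rightCont

/-- `F_∞`. -/
noncomputable abbrev filtInfty : MeasurableSpace Ω := ⨆ t, S.filt t

/-- `F_t`-adapted processes all of whose paths are nondecreasing and right-continuous with values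
in `[0, ∞)`. -/
structure IsFront (s : ℝ≥0 → Ω → ℝ) : Prop where
  adapted : ∀ t, Measurable[S.filt t] (s t)
  nonneg : ∀ t ω, 0 ≤ s t ω
  mono : ∀ ω, Monotone fun t => s t ω
  rightCont : ∀ ω t, ContinuousWithinAt (fun r => s r ω) (Ici t) t

/-- `X^y_t = y + √(2κ - θ²) B_t + θ W_t`. -/
noncomputable def X (y : ℝ) (t : ℝ≥0) (ω : Ω) : ℝ :=
  y + √(2 * S.kap - S.theta ^ 2) * S.B t ω + S.theta * S.W t ω

/-- `τ^{y,s} = inf {t ≥ 0 : X^y_t ≤ s(t)}`, with `inf ∅ = ∞`. -/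
noncomputable def tau (s : ℝ≥0 → Ω → ℝ) (y : ℝ) (ω : Ω) : ℝ≥0∞ :=
  ⨅ (t : ℝ≥0) (_ : S.X y t ω ≤ s t ω), (t : ℝ≥0∞)

/-- `g = s₀ + (1/λκ) ∫_{[s₀,∞)} P(τ^{y,s} ≤ t ∣ m) ν₀(dy)` almost surely. -/
def IsFrontAverage {Ω : Type*} (m : MeasurableSpace Ω) [MeasurableSpace Ω] {μ : Measure Ω}
    (S : Setting Ω μ) (s : ℝ≥0 → Ω → ℝ) (t : ℝ≥0) (g : Ω → ℝ) : Prop :=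
  ∃ p : ℝ → Ω → ℝ, IsCondProbVersion m μ (fun y => {ω | S.tau s y ω ≤ t}) p ∧
    ∀ᵐ ω ∂μ, g ω = S.s0 ω + 1 / (S.lam * S.kap) * ∫ y in Ici (S.s0 ω), p y ω ∂(S.nu0 ω)

/-- Solutions of the conditional McKean–Vlasov problem. -/
structure IsSolution (s : ℝ≥0 → Ω → ℝ) : Prop where
  isFront : S.IsFront s
  eq : ∀ t, IsFrontAverage (S.filt t) S s t (s t)

/-- The minimal solution: the least solution for the order `s ≤ s'` iff almost surely
`s(t) ≤ s'(t)` for all `t ≥ 0`. -/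
structure IsMinimalSolution (s : ℝ≥0 → Ω → ℝ) : Prop where
  isSolution : S.IsSolution s
  le : ∀ s', S.IsSolution s' → ∀ᵐ ω ∂μ, ∀ t, s t ω ≤ s' t ω

/-- `g = Γ[s]`: the process `g` is the version, with paths in the path space above, of
`t ↦ s₀ + (1/λκ) ∫_{[s₀,∞)} P(τ^{y,s} ≤ t ∣ F_∞) ν₀(dy)`. -/
structure IsGamma (s g : ℝ≥0 → Ω → ℝ) : Prop where
  isFront : S.IsFront g
  eq : ∀ t, IsFrontAverage S.filtInfty S s t (g t)

/-- `g n = Γ^n[0]` for all `n`. -/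
structure IsGammaIterates (g : ℕ → ℝ≥0 → Ω → ℝ) : Prop where
  zero : g 0 = fun _ _ => 0
  succ : ∀ n, S.IsGamma (g n) (g (n + 1))

/-- Almost surely, `(1/λκ) ν₀([s₀, s₀ + y]) < y` infinitely often as `y ↓ 0`. -/
def InitialAligned : Prop :=
  ∀ᵐ ω ∂μ, ∃ᶠ y in 𝓝[>] (0 : ℝ),
    1 / (S.lam * S.kap) * (S.nu0 ω).real (Icc (S.s0 ω) (S.s0 ω + y)) < y

end Setting

end StefanMV

/-!
Why the theorem holds. Fix a realisation `ω` of the initial data and of the common noise `W`. As `B`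
is independent of `F_∞`, conditioning on `F_∞` amounts to averaging over `B` alone
(`condHitProb_ae_eq_filtInfty`), and since the frozen hitting probability up to time `t` is already
`F_t`-measurable, conditioning on `F_t` gives the same result (`condHitProb_ae_eq_filt`). Hence both
the equation for solutions and the operator `Γ` are, almost surely, given by one deterministic
monotone operator `frontOp` acting on the path `s(ω)`: a front is a solution if and only if almost
every path is a fixed point (`isSolution_iff`).

For fixed `ω`, the iterates of `frontOp` started from `0` increase to a limit `frontLim`, whose
right-continuous modification `minFront` lies below every fixed point (`minFront_le`) and agrees with
`frontLim` at positive times where it is continuous (`tendsto_frontIter_of_continuousAt`). That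
`minFront` is a fixed point itself (`frontOp_minFront`) comes down to passing to the limit in the
hitting probabilities. A path that strictly crosses `minFront` hits some iterate slightly later, so what has to be excluded is
that a path touches `minFront` without crossing it. After a positive time this has probability zero,
for any front, because the running maximum of `f - θ W - σ B` has no atoms: it is the sum of a
Gaussian variable and an independent one (`measure_touch_after`). At time `0` it has probability zero
because `σ B + θ W` takes negative values immediately (`ae_measure_forall_nonneg_eq_zero`); by time
inversion this reduces to a Borel-Cantelli argument along rapidly growing times.

Finally, if `c ν₀[s₀, s₀ + y] < y`, where `c = 1/λκ`, then the constant `s₀ + y` is a strict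
supersolution at time `0`, hence by right-continuity a supersolution for a short time, and all
iterates stay below it (`minFront_zero_le`). Letting `y ↓ 0` along such values gives `s(0) = s₀`.
-/

namespace StefanMV

/-! ### Paths hitting a moving boundary -/

/-- Nondecreasing right-continuous functions on `[0, ∞)`: the paths of a front. -/
structure IsFrontPath (f : ℝ≥0 → ℝ) : Prop where
  mono : Monotone f
  rightCont : ∀ t, ContinuousWithinAt f (Ici t) t

/-- The path `y + x` is at or below the boundary `f` at some time in `[0, t]`. -/
def Hits (x f : ℝ≥0 → ℝ) (t : ℝ≥0) (y : ℝ) : Prop := ∃ r ≤ t, y + x r ≤ f r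

/-- The path `y + x` is strictly below the boundary `f` at some time in `[0, t]`. -/
def Crosses (x f : ℝ≥0 → ℝ) (t : ℝ≥0) (y : ℝ) : Prop := ∃ r ≤ t, y + x r < f r

theorem Hits.mono {x f g : ℝ≥0 → ℝ} {t u : ℝ≥0} {y z : ℝ} (h : Hits x f t y)
    (hfg : ∀ r ≤ t, f r ≤ g r) (htu : t ≤ u) (hzy : z ≤ y) : Hits x g u z := by
  obtain ⟨r, hr, h⟩ := h
  exact ⟨r, hr.trans htu, by linarith [hfg r hr]⟩

theorem Hits.crosses_of_lt {x f : ℝ≥0 → ℝ} {t : ℝ≥0} {y z : ℝ} (h : Hits x f t y) (hz : z < y) :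
    Crosses x f t z := by
  obtain ⟨r, hr, h⟩ := h
  exact ⟨r, hr, by linarith⟩

section Path

variable {x f : ℝ≥0 → ℝ} (hx : Continuous x) (hf : IsFrontPath f)
include hx hf

/-- The gap `f - x` only has upward jumps and is right-continuous, hence it attains its maximum on
compact time intervals. -/
theorem IsFrontPath.exists_max (t : ℝ≥0) : ∃ r ≤ t, ∀ q ≤ t, f q - x q ≤ f r - x r := by
  have husc : UpperSemicontinuous fun r => f r - x r := by
    intro r
    have h1 : UpperSemicontinuousAt f r := by
      intro c hc
      have h2 := (hf.rightCont r).eventually_lt_const hc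
      rw [← nhdsLE_sup_nhdsGE]
      refine eventually_sup.2 ⟨?_, h2⟩
      filter_upwards [self_mem_nhdsWithin] with q hq
      exact (hf.mono hq).trans_lt hc
    have h3 : UpperSemicontinuousAt (fun r => - x r) r :=
      hx.neg.continuousAt.upperSemicontinuousAt
    simpa only [sub_eq_add_neg] using h1.add h3
  obtain ⟨r, hr, hmax⟩ := (husc.upperSemicontinuousOn (Icc 0 t)).exists_isMaxOn
    ⟨0, by simp⟩ isCompact_Icc
  exact ⟨r, hr.2, fun q hq => hmax ⟨zero_le, hq⟩⟩

theorem hits_iff_forall_crosses {t : ℝ≥0} {y : ℝ} :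
    Hits x f t y ↔ ∀ k : ℕ, Crosses x f t (y - 1 / (k + 1)) := by
  refine ⟨fun h k => h.crosses_of_lt (sub_lt_self _ (by positivity)), fun h => ?_⟩
  obtain ⟨r, hr, hmax⟩ := hf.exists_max hx t
  refine ⟨r, hr, ?_⟩
  by_contra! hlt
  obtain ⟨k, hk⟩ := exists_nat_one_div_lt (sub_pos.2 hlt)
  obtain ⟨q, hq, hc⟩ := h k
  linarith [hmax q hq]

theorem hits_of_forall_lt {t : ℝ≥0} {y : ℝ} (h : ∀ z < y, Hits x f t z) : Hits x f t y := by
  rw [hits_iff_forall_crosses hx hf]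
  intro k
  have hk : (0 : ℝ) < 1 / (k + 1) := by positivity
  exact (h (y - 1 / (k + 1) / 2) (by linarith)).crosses_of_lt (by linarith)

omit hf in
theorem eventually_right_lt {r : ℝ≥0} {y : ℝ} (hr : ContinuousWithinAt f (Ici r) r)
    (h : y + x r < f r) : ∀ᶠ q in 𝓝[≥] r, y + x q < f q :=
  ((continuous_const.add hx).continuousWithinAt).eventually_lt hr h

theorem hits_of_forall_gt {t : ℝ≥0} {y : ℝ} (h : ∀ u > t, Hits x f u y) : Hits x f t y := by
  by_contra hno
  have hno' : ∀ r ≤ t, f r < y + x r := by simpa [Hits] using hno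
  have h1 : ∀ᶠ q in 𝓝[≥] t, f q < y + x q :=
    (hf.rightCont t).eventually_lt ((continuous_const.add hx).continuousWithinAt) (hno' t le_rfl)
  obtain ⟨u, hu, hsub⟩ := mem_nhdsGE_iff_exists_Ico_subset.1 h1
  obtain ⟨v, hv1, hv2⟩ := exists_between (show t < u from hu)
  obtain ⟨r, hr, hle⟩ := h v hv1
  rcases le_total r t with hrt | hrt
  · exact absurd (hno' r hrt) hle.not_gt
  · exact absurd (hsub ⟨hrt, hr.trans_lt hv2⟩) hle.not_gt

/-- Crossing only has to be tested at countably many times, which do not depend on the paths. -/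
theorem crosses_iff_exists_denseSeq {t : ℝ≥0} {y : ℝ} :
    Crosses x f t y ↔ ∃ n, y + x (min (TopologicalSpace.denseSeq ℝ≥0 n) t) <
      f (min (TopologicalSpace.denseSeq ℝ≥0 n) t) := by
  refine ⟨fun ⟨r, hr, h⟩ => ?_, fun ⟨q, h⟩ => ⟨_, min_le_right _ _, h⟩⟩
  have hd := TopologicalSpace.denseRange_denseSeq ℝ≥0
  rcases hr.eq_or_lt with rfl | hr
  · obtain ⟨_, ⟨n, rfl⟩, hn, -⟩ := hd.exists_between (lt_add_one r)
    exact ⟨n, by rwa [min_eq_right hn.le]⟩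
  · obtain ⟨u, hu, hsub⟩ := mem_nhdsGE_iff_exists_Ico_subset.1
      (eventually_right_lt hx (hf.rightCont r) h)
    obtain ⟨_, ⟨n, rfl⟩, hn1, hn2⟩ := hd.exists_between (lt_min (show r < u from hu) hr)
    refine ⟨n, ?_⟩
    rw [min_eq_left (hn2.trans_le (min_le_right _ _)).le]
    exact hsub ⟨hn1.le, hn2.trans_le (min_le_left _ _)⟩

end Path

theorem measurableSet_crosses {E : Type*} [MeasurableSpace E] {x f : ℝ≥0 → E → ℝ} {t : ℝ≥0}
    {y : E → ℝ} (hx : ∀ e, Continuous fun r => x r e) (hf : ∀ e, IsFrontPath fun r => f r e)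
    (hxm : ∀ r ≤ t, Measurable (x r)) (hfm : ∀ r ≤ t, Measurable (f r)) (hy : Measurable y) :
    MeasurableSet {e | Crosses (fun r => x r e) (fun r => f r e) t (y e)} := by
  have h : {e | Crosses (fun r => x r e) (fun r => f r e) t (y e)} =
      ⋃ n, {e | y e + x (min (TopologicalSpace.denseSeq ℝ≥0 n) t) e <
        f (min (TopologicalSpace.denseSeq ℝ≥0 n) t) e} := by
    ext e
    simpa using crosses_iff_exists_denseSeq (hx e) (hf e)
  rw [h]
  exact MeasurableSet.iUnion fun n => measurableSet_lt
    (hy.add (hxm _ (min_le_right _ _))) (hfm _ (min_le_right _ _))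

theorem measurableSet_hits {E : Type*} [MeasurableSpace E] {x f : ℝ≥0 → E → ℝ} {t : ℝ≥0}
    {y : E → ℝ} (hx : ∀ e, Continuous fun r => x r e) (hf : ∀ e, IsFrontPath fun r => f r e)
    (hxm : ∀ r ≤ t, Measurable (x r)) (hfm : ∀ r ≤ t, Measurable (f r)) (hy : Measurable y) :
    MeasurableSet {e | Hits (fun r => x r e) (fun r => f r e) t (y e)} := by
  have h : {e | Hits (fun r => x r e) (fun r => f r e) t (y e)} =
      ⋂ k : ℕ, {e | Crosses (fun r => x r e) (fun r => f r e) t (y e - 1 / (k + 1))} := by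
    ext e
    simpa using hits_iff_forall_crosses (hx e) (hf e)
  rw [h]
  exact MeasurableSet.iInter fun k =>
    measurableSet_crosses hx hf hxm hfm (hy.sub measurable_const)

/-! ### The front operator for a frozen common noise -/

section Operator

variable {Ω : Type*} [MeasurableSpace Ω] (P : Measure Ω) [IsProbabilityMeasure P]
  (x : ℝ≥0 → Ω → ℝ)

/-- The probability that the random path `y + x` hits the deterministic front `f` by time `t`. -/
noncomputable def hitProb (f : ℝ≥0 → ℝ) (t : ℝ≥0) (y : ℝ) : ℝ :=
  P.real {ω | Hits (fun r => x r ω) f t y}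

/-- The front operator for one realisation of the initial data and of the common noise: `ν`, `a`
and `c` stand for `ν₀`, `s₀` and `1/λκ`, and `x` is the noise, which remains random only through
the idiosyncratic Brownian motion. -/
noncomputable def frontOp (ν : Measure ℝ) (a c : ℝ) (f : ℝ≥0 → ℝ) (t : ℝ≥0) : ℝ :=
  a + c * ∫ y in Ici a, hitProb P x f t y ∂ν

variable {P x} {f g : ℝ≥0 → ℝ} {ν : Measure ℝ} {a c : ℝ}

omit [IsProbabilityMeasure P] in
theorem hitProb_nonneg (f : ℝ≥0 → ℝ) (t : ℝ≥0) (y : ℝ) : 0 ≤ hitProb P x f t y :=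
  measureReal_nonneg

theorem hitProb_le_one (f : ℝ≥0 → ℝ) (t : ℝ≥0) (y : ℝ) : hitProb P x f t y ≤ 1 :=
  measureReal_le_one

theorem hitProb_mono {t u : ℝ≥0} {y z : ℝ} (hfg : ∀ r ≤ t, f r ≤ g r) (htu : t ≤ u) (hzy : z ≤ y) :
    hitProb P x f t y ≤ hitProb P x g u z :=
  measureReal_mono fun _ h => Hits.mono h hfg htu hzy

theorem hitProb_antitone (f : ℝ≥0 → ℝ) (t : ℝ≥0) : Antitone (hitProb P x f t) :=
  fun _ _ h => hitProb_mono (fun _ _ => le_rfl) le_rfl h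

theorem integrable_hitProb [IsFiniteMeasure ν] (f : ℝ≥0 → ℝ) (t : ℝ≥0) :
    Integrable (hitProb P x f t) ν :=
  Integrable.of_bound (hitProb_antitone f t).measurable.aestronglyMeasurable 1
    (ae_of_all _ fun y => by
      rw [Real.norm_of_nonneg (hitProb_nonneg f t y)]; exact hitProb_le_one f t y)

theorem frontOp_mono [IsFiniteMeasure ν] (hc : 0 ≤ c) {t u : ℝ≥0} (hfg : ∀ r ≤ t, f r ≤ g r)
    (htu : t ≤ u) : frontOp P x ν a c f t ≤ frontOp P x ν a c g u := by
  have h := integral_mono (integrable_hitProb (P := P) (x := x) (ν := ν.restrict (Ici a)) f t)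
    (integrable_hitProb g u) fun y => hitProb_mono hfg htu le_rfl
  exact add_le_add le_rfl (mul_le_mul_of_nonneg_left h hc)

omit [IsProbabilityMeasure P] in
theorem le_frontOp (hc : 0 ≤ c) (f : ℝ≥0 → ℝ) (t : ℝ≥0) : a ≤ frontOp P x ν a c f t :=
  le_add_of_nonneg_right (mul_nonneg hc (integral_nonneg fun y => hitProb_nonneg f t y))

theorem frontOp_le [IsFiniteMeasure ν] (hc : 0 ≤ c) (f : ℝ≥0 → ℝ) (t : ℝ≥0) :
    frontOp P x ν a c f t ≤ a + c * ν.real (Ici a) := by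
  unfold frontOp
  gcongr
  calc ∫ y in Ici a, hitProb P x f t y ∂ν ≤ ∫ _ in Ici a, (1 : ℝ) ∂ν :=
        integral_mono (integrable_hitProb f t) (integrable_const _) fun y => hitProb_le_one f t y
    _ = ν.real (Ici a) := by simp

/-- Passage to the limit under the integral defining the front operator. -/
theorem tendsto_integral_hitProb [IsFiniteMeasure ν] {ι : Type*} {l : Filter ι}
    [l.IsCountablyGenerated] {F : ι → ℝ≥0 → ℝ} {τ : ι → ℝ≥0} {p : ℝ → ℝ}
    (h : ∀ y, Tendsto (fun i => hitProb P x (F i) (τ i) y) l (𝓝 (p y))) :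
    Tendsto (fun i => ∫ y in Ici a, hitProb P x (F i) (τ i) y ∂ν) l
      (𝓝 (∫ y in Ici a, p y ∂ν)) :=
  tendsto_integral_filter_of_dominated_convergence (fun _ => 1)
    (Eventually.of_forall fun i => (integrable_hitProb _ _).aestronglyMeasurable)
    (Eventually.of_forall fun i => ae_of_all _ fun y => by
      rw [Real.norm_of_nonneg (hitProb_nonneg _ _ _)]; exact hitProb_le_one _ _ _)
    (integrable_const _) (ae_of_all _ h)

variable (hxc : ∀ ω, Continuous fun r => x r ω) (hxm : ∀ r, Measurable (x r))

include hxc hxm in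
theorem measurableSet_hits_path (hf : IsFrontPath f) (t : ℝ≥0) (y : ℝ) :
    MeasurableSet {ω | Hits (fun r => x r ω) f t y} :=
  measurableSet_hits (f := fun r _ => f r) hxc (fun _ => hf) (fun r _ => hxm r)
    (fun _ _ => measurable_const) measurable_const

include hxc hxm in
theorem tendsto_hitProb_time (hf : IsFrontPath f) (t : ℝ≥0) (y : ℝ) :
    Tendsto (fun u => hitProb P x f u y) (𝓝[>] t) (𝓝 (hitProb P x f t y)) := by
  have h := tendsto_measure_biInter_gt (μ := P) (a := t)
    (s := fun u => {ω | Hits (fun r => x r ω) f u y})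
    (fun u _ => (measurableSet_hits_path hxc hxm hf u y).nullMeasurableSet)
    (fun u v _ huv ω hω => Hits.mono hω (fun _ _ => le_rfl) huv le_rfl)
    ⟨t + 1, lt_add_one t, measure_ne_top _ _⟩
  have hset : (⋂ u > t, {ω | Hits (fun r => x r ω) f u y}) = {ω | Hits (fun r => x r ω) f t y} := by
    ext ω
    simp only [mem_iInter, mem_ofPred_eq]
    exact ⟨fun h => hits_of_forall_gt (hxc ω) hf h,
      fun h u hu => Hits.mono h (fun _ _ => le_rfl) (le_of_lt hu) le_rfl⟩
  rw [hset] at h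
  exact (ENNReal.tendsto_toReal (measure_ne_top _ _)).comp h

include hxc hxm in
theorem continuousWithinAt_hitProb (hf : IsFrontPath f) (t : ℝ≥0) (y : ℝ) :
    ContinuousWithinAt (hitProb P x f t) (Iic y) y := by
  have h := tendsto_measure_biInter_gt (μ := P) (a := OrderDual.toDual y)
    (s := fun u => {ω | Hits (fun r => x r ω) f t (OrderDual.ofDual u)})
    (fun u _ => (measurableSet_hits_path hxc hxm hf t _).nullMeasurableSet)
    (fun u v _ huv ω hω => Hits.mono hω (fun _ _ => le_rfl) le_rfl huv)
    ⟨OrderDual.toDual (y - 1), sub_one_lt y, measure_ne_top _ _⟩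
  have hset : (⋂ u > OrderDual.toDual y, {ω | Hits (fun r => x r ω) f t (OrderDual.ofDual u)}) =
      {ω | Hits (fun r => x r ω) f t y} := by
    ext ω
    simp only [mem_iInter, mem_ofPred_eq]
    exact ⟨fun h => hits_of_forall_lt (hxc ω) hf fun z hz => h (OrderDual.toDual z) hz,
      fun h u hu => Hits.mono h (fun _ _ => le_rfl) le_rfl (le_of_lt hu)⟩
  rw [hset] at h
  exact continuousWithinAt_Iio_iff_Iic.1 ((ENNReal.tendsto_toReal (measure_ne_top _ _)).comp h)

include hxc hxm in
/-- The front operator maps front paths to front paths. -/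
theorem isFrontPath_frontOp [IsFiniteMeasure ν] (hc : 0 ≤ c) (hf : IsFrontPath f) :
    IsFrontPath (frontOp P x ν a c f) where
  mono _ _ htu := frontOp_mono hc (fun _ _ => le_rfl) htu
  rightCont t := continuousWithinAt_Ioi_iff_Ici.1 <|
    ((tendsto_integral_hitProb fun y => tendsto_hitProb_time hxc hxm hf t y).const_mul c).const_add a

end Operator
/-! ### The least fixed point of the front operator -/

section LeastFixedPoint

variable {Ω : Type*} [MeasurableSpace Ω] (P : Measure Ω) (x : ℝ≥0 → Ω → ℝ)
  (ν : Measure ℝ) (a c : ℝ)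

/-- The iterates of the front operator started from `0`. -/
noncomputable def frontIter : ℕ → ℝ≥0 → ℝ
  | 0 => fun _ => 0
  | n + 1 => frontOp P x ν a c (frontIter n)

/-- The increasing limit of the iterates. It need not be right-continuous. -/
noncomputable def frontLim (t : ℝ≥0) : ℝ := ⨆ n, frontIter P x ν a c n t

/-- The least front: the right-continuous modification of the limit of the iterates. -/
noncomputable def minFront : ℝ≥0 → ℝ := Function.rightLim (frontLim P x ν a c)

variable {P x ν a c} [IsProbabilityMeasure P] [IsFiniteMeasure ν] (ha : 0 ≤ a) (hc : 0 ≤ c)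
  (hxc : ∀ ω, Continuous fun r => x r ω) (hxm : ∀ r, Measurable (x r))

include hc hxc hxm in
theorem isFrontPath_frontIter (n : ℕ) : IsFrontPath (frontIter P x ν a c n) := by
  induction n with
  | zero => exact ⟨fun _ _ _ => le_rfl, fun _ => continuousWithinAt_const⟩
  | succ n ih => exact isFrontPath_frontOp hxc hxm hc ih

omit [IsProbabilityMeasure P] [IsFiniteMeasure ν] in
include ha hc in
theorem frontIter_nonneg (n : ℕ) (t : ℝ≥0) : 0 ≤ frontIter P x ν a c n t := by
  cases n with
  | zero => exact le_rfl
  | succ n => exact ha.trans (le_frontOp hc _ t)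

include ha hc in
theorem monotone_frontIter : Monotone (frontIter P x ν a c) := by
  refine monotone_nat_of_le_succ fun n => ?_
  induction n with
  | zero => exact fun t => frontIter_nonneg ha hc 1 t
  | succ n ih => exact fun t => frontOp_mono hc (fun r _ => ih r) le_rfl

include ha hc in
theorem bddAbove_frontIter (t : ℝ≥0) : BddAbove (range fun n => frontIter P x ν a c n t) := by
  refine ⟨a + c * ν.real (Ici a), ?_⟩
  rintro _ ⟨n, rfl⟩
  cases n with
  | zero => exact add_nonneg ha (mul_nonneg hc measureReal_nonneg)
  | succ n => exact frontOp_le hc _ t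

include ha hc in
theorem tendsto_frontIter (t : ℝ≥0) :
    Tendsto (fun n => frontIter P x ν a c n t) atTop (𝓝 (frontLim P x ν a c t)) :=
  tendsto_atTop_ciSup (fun _ _ h => monotone_frontIter ha hc h t) (bddAbove_frontIter ha hc t)

include ha hc in
theorem frontIter_le_frontLim (n : ℕ) (t : ℝ≥0) :
    frontIter P x ν a c n t ≤ frontLim P x ν a c t :=
  le_ciSup (bddAbove_frontIter ha hc t) n

include ha hc hxc hxm in
theorem monotone_frontLim : Monotone (frontLim P x ν a c) := fun _ u htu =>
  ciSup_mono (bddAbove_frontIter ha hc u) fun n =>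
    (isFrontPath_frontIter hc hxc hxm n).mono htu

include ha hc hxc hxm in
theorem isFrontPath_minFront : IsFrontPath (minFront P x ν a c) :=
  ⟨(monotone_frontLim ha hc hxc hxm).stieltjesFunction.mono,
    (monotone_frontLim ha hc hxc hxm).stieltjesFunction.right_continuous⟩

include ha hc hxc hxm in
theorem tendsto_frontLim (t : ℝ≥0) :
    Tendsto (frontLim P x ν a c) (𝓝[>] t) (𝓝 (minFront P x ν a c t)) :=
  (monotone_frontLim ha hc hxc hxm).tendsto_rightLim t

include ha hc hxc hxm in
theorem frontLim_le_minFront (t : ℝ≥0) : frontLim P x ν a c t ≤ minFront P x ν a c t :=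
  (monotone_frontLim ha hc hxc hxm).le_rightLim le_rfl

include ha hc hxc hxm in
theorem frontIter_le_minFront (n : ℕ) (t : ℝ≥0) :
    frontIter P x ν a c n t ≤ minFront P x ν a c t :=
  (frontIter_le_frontLim ha hc n t).trans (frontLim_le_minFront ha hc hxc hxm t)

include ha hc hxc hxm in
theorem le_minFront (t : ℝ≥0) : a ≤ minFront P x ν a c t :=
  (le_frontOp hc _ t).trans (frontIter_le_minFront ha hc hxc hxm 1 t)

include ha hc hxc hxm in
/-- The least front lies below every front that the front operator does not increase. -/
theorem minFront_le {g : ℝ≥0 → ℝ} (hg : IsFrontPath g) (hg0 : ∀ t, 0 ≤ g t)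
    (hfix : ∀ t, frontOp P x ν a c g t ≤ g t) (t : ℝ≥0) : minFront P x ν a c t ≤ g t := by
  have hn : ∀ n t, frontIter P x ν a c n t ≤ g t := by
    intro n
    induction n with
    | zero => exact hg0
    | succ n ih => exact fun t => (frontOp_mono hc (fun r _ => ih r) le_rfl).trans (hfix t)
  refine le_of_tendsto_of_tendsto (tendsto_frontLim ha hc hxc hxm t)
    ((hg.rightCont t).mono_left (nhdsWithin_mono t Ioi_subset_Ici_self)) ?_
  exact Eventually.of_forall fun u => ciSup_le fun n => hn n u

include ha hc hxc hxm in
theorem frontLim_le_frontOp_minFront (t : ℝ≥0) :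
    frontLim P x ν a c t ≤ frontOp P x ν a c (minFront P x ν a c) t := by
  refine ciSup_le fun n => ?_
  cases n with
  | zero => exact ha.trans (le_frontOp hc _ t)
  | succ n => exact frontOp_mono hc (fun r _ => frontIter_le_minFront ha hc hxc hxm n r) le_rfl

include ha hc hxc hxm in
/-- A path that crosses the least front by time `t` has hit some iterate by any later time. -/
theorem exists_hits_frontIter {ω : Ω} {t u : ℝ≥0} (htu : t < u) {y : ℝ}
    (h : Crosses (fun r => x r ω) (minFront P x ν a c) t y) :
    ∃ n, Hits (fun r => x r ω) (frontIter P x ν a c n) u y := by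
  obtain ⟨r, hr, hlt⟩ := h
  have h1 : ∀ᶠ q in 𝓝[>] r, y + x q ω < frontLim P x ν a c q :=
    ((continuous_const.add (hxc ω)).continuousWithinAt.tendsto).eventually_lt
      (tendsto_frontLim ha hc hxc hxm r) hlt
  obtain ⟨q, hq1, hq2⟩ := (h1.and (Ioo_mem_nhdsGT (hr.trans_lt htu))).exists
  obtain ⟨n, hn⟩ := exists_lt_of_lt_ciSup hq1
  exact ⟨n, q, hq2.2.le, hn.le⟩

include ha hc hxc hxm in
theorem frontOp_minFront_le_frontLim
    {t u : ℝ≥0} (htu : t < u)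
    (hreg : ∀ y, P {ω | Hits (fun r => x r ω) (minFront P x ν a c) t y ∧
      ¬ Crosses (fun r => x r ω) (minFront P x ν a c) t y} = 0) :
    frontOp P x ν a c (minFront P x ν a c) t ≤ frontLim P x ν a c u := by
  set U : ℝ → Set Ω := fun y => ⋃ n, {ω | Hits (fun r => x r ω) (frontIter P x ν a c n) u y}
  have hU : ∀ y, Tendsto (fun n => hitProb P x (frontIter P x ν a c n) u y) atTop
      (𝓝 (P.real (U y))) := fun y =>
    (ENNReal.tendsto_toReal (measure_ne_top _ _)).comp <|
      tendsto_measure_iUnion_atTop fun n m hnm ω hω =>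
        Hits.mono hω (fun r _ => monotone_frontIter ha hc hnm r) le_rfl le_rfl
  have hle : ∀ y, hitProb P x (minFront P x ν a c) t y ≤ P.real (U y) := fun y => by
    refine ENNReal.toReal_mono (measure_ne_top _ _) (measure_mono_ae ?_)
    have h0 : ∀ᵐ ω ∂P, ¬ (Hits (fun r => x r ω) (minFront P x ν a c) t y ∧
      ¬ Crosses (fun r => x r ω) (minFront P x ν a c) t y) := by
        rw [ae_iff]; simpa only [not_not] using hreg y
    filter_upwards [h0] with ω hω hhit
    exact mem_iUnion.2 (exists_hits_frontIter ha hc hxc hxm htu (by tauto))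
  have hUanti : Antitone fun y => P.real (U y) := fun y z hyz =>
    measureReal_mono (iUnion_mono fun n ω hω => Hits.mono hω (fun _ _ => le_rfl) le_rfl hyz)
  have hUint : Integrable (fun y => P.real (U y)) (ν.restrict (Ici a)) :=
    Integrable.of_bound hUanti.measurable.aestronglyMeasurable 1
      (ae_of_all _ fun y => by
        rw [Real.norm_of_nonneg measureReal_nonneg]; exact measureReal_le_one)
  have hlim : Tendsto (fun n => frontIter P x ν a c (n + 1) u) atTop
      (𝓝 (a + c * ∫ y in Ici a, P.real (U y) ∂ν)) :=
    ((tendsto_integral_hitProb hU).const_mul c).const_add a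
  rw [tendsto_nhds_unique ((tendsto_frontIter ha hc u).comp (tendsto_add_atTop_nat 1)) hlim]
  have hint := integral_mono (integrable_hitProb (P := P) (x := x) (ν := ν.restrict (Ici a))
    (minFront P x ν a c) t) hUint hle
  exact add_le_add le_rfl (mul_le_mul_of_nonneg_left hint hc)

include ha hc hxc hxm in
/-- If a path from any given starting point almost surely crosses the least front whenever it touches
it, then the least front is a fixed point of the front operator. -/
theorem frontOp_minFront
    (hreg : ∀ t > 0, ∀ y, P {ω | Hits (fun r => x r ω) (minFront P x ν a c) t y ∧
      ¬ Crosses (fun r => x r ω) (minFront P x ν a c) t y} = 0) (t : ℝ≥0) :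
    frontOp P x ν a c (minFront P x ν a c) t = minFront P x ν a c t := by
  have hop : IsFrontPath (frontOp P x ν a c (minFront P x ν a c)) :=
    isFrontPath_frontOp hxc hxm hc (isFrontPath_minFront ha hc hxc hxm)
  have hop' : ∀ t, Tendsto (frontOp P x ν a c (minFront P x ν a c)) (𝓝[>] t)
      (𝓝 (frontOp P x ν a c (minFront P x ν a c) t)) := fun t =>
    (hop.rightCont t).mono_left (nhdsWithin_mono t Ioi_subset_Ici_self)
  have hpos : ∀ t > 0, frontOp P x ν a c (minFront P x ν a c) t = minFront P x ν a c t := by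
    intro t ht
    refine le_antisymm ?_ ?_
    · refine ge_of_tendsto (tendsto_frontLim ha hc hxc hxm t) ?_
      filter_upwards [self_mem_nhdsWithin] with u hu
      exact frontOp_minFront_le_frontLim ha hc hxc hxm hu (hreg t ht)
    · exact le_of_tendsto_of_tendsto' (tendsto_frontLim ha hc hxc hxm t) (hop' t)
        (frontLim_le_frontOp_minFront ha hc hxc hxm)
  rcases eq_zero_or_pos t with rfl | ht
  · refine tendsto_nhds_unique (hop' 0) (Tendsto.congr' ?_
      (((isFrontPath_minFront ha hc hxc hxm).rightCont 0).mono_left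
        (nhdsWithin_mono 0 Ioi_subset_Ici_self)))
    filter_upwards [self_mem_nhdsWithin] with u hu
    exact (hpos u hu).symm
  · exact hpos t ht

include ha hc hxc hxm in
theorem tendsto_frontIter_of_continuousAt {t : ℝ≥0} (ht : 0 < t)
    (hcont : ContinuousAt (minFront P x ν a c) t) :
    Tendsto (fun n => frontIter P x ν a c n t) atTop (𝓝 (minFront P x ν a c t)) := by
  have h : frontLim P x ν a c t = minFront P x ν a c t := by
    refine le_antisymm (frontLim_le_minFront ha hc hxc hxm t) ?_
    have : (𝓝[<] t).NeBot := nhdsLT_neBot_of_exists_lt ⟨0, ht⟩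
    refine le_of_tendsto (hcont.tendsto.mono_left (nhdsWithin_le_nhds (s := Iio t))) ?_
    filter_upwards [self_mem_nhdsWithin] with u hu
    exact (monotone_frontLim ha hc hxc hxm).rightLim_le hu
  exact h ▸ tendsto_frontIter ha hc t

include ha hc hxc hxm in
/-- A level `a + y` with `c ν[a, a + y] < y` is, for a short time, a constant supersolution, so that
all iterates stay below it. -/
theorem minFront_zero_le (hx0 : ∀ ω, x 0 ω = 0) {y : ℝ} (hy : 0 < y)
    (hlt : c * ν.real (Icc a (a + y)) < y) : minFront P x ν a c 0 ≤ a + y := by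
  have hk : IsFrontPath fun _ => a + y := ⟨fun _ _ _ => le_rfl, fun _ => continuousWithinAt_const⟩
  have h0 : frontOp P x ν a c (fun _ => a + y) 0 < a + y := by
    have h1 : ∀ z, hitProb P x (fun _ => a + y) 0 z = (Iic (a + y)).indicator 1 z := by
      intro z
      by_cases hz : z ≤ a + y <;> simp [hitProb, Hits, hx0, hz]
    have h2 : ∫ z in Ici a, hitProb P x (fun _ => a + y) 0 z ∂ν = ν.real (Icc a (a + y)) := by
      simp_rw [h1]
      rw [integral_indicator_one measurableSet_Iic, measureReal_restrict_apply measurableSet_Iic,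
        Iic_inter_Ici]
    simpa [frontOp, h2] using hlt
  have h1 := ((isFrontPath_frontOp (ν := ν) (a := a) hxc hxm hc hk).rightCont 0).eventually_lt_const h0
  obtain ⟨ε, hε, hε0⟩ := ((h1.filter_mono (nhdsWithin_mono 0 Ioi_subset_Ici_self)).and
    self_mem_nhdsWithin).exists
  have hn : ∀ n, ∀ t ≤ ε, frontIter P x ν a c n t ≤ a + y := by
    intro n
    induction n with
    | zero => exact fun t _ => by change 0 ≤ a + y; positivity
    | succ n ih => exact fun t ht =>
        (frontOp_mono hc (fun r hr => ih r (hr.trans ht)) ht).trans hε.le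
  calc minFront P x ν a c 0 ≤ frontLim P x ν a c ε :=
        (monotone_frontLim ha hc hxc hxm).rightLim_le hε0
    _ ≤ a + y := ciSup_le fun n => hn n ε le_rfl

include ha hc hxc hxm in
theorem minFront_zero (hx0 : ∀ ω, x 0 ω = 0)
    (hfreq : ∃ᶠ y in 𝓝[>] (0 : ℝ), c * ν.real (Icc a (a + y)) < y) :
    minFront P x ν a c 0 = a := by
  refine le_antisymm (le_of_forall_pos_le_add fun δ hδ => ?_) (le_minFront ha hc hxc hxm 0)
  obtain ⟨y, hy, hy0, hyδ⟩ := (hfreq.and_eventually (Ioo_mem_nhdsGT hδ)).exists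
  exact (minFront_zero_le ha hc hxc hxm hx0 hy0 hy).trans (by linarith)

end LeastFixedPoint
/-! ### Brownian motion with a frozen continuous drift -/

section Brownian

variable {Ω : Type*} [MeasurableSpace Ω] {P : Measure Ω} [IsProbabilityMeasure P]

/-- Two independent real random variables, one of which has no atoms, almost surely differ. -/
theorem measure_eq_of_indepFun_of_nullSingleton {U V : Ω → ℝ} (hU : Measurable U) (hV : Measurable V)
    (h : IndepFun U V P) [NullSingletonClass (P.map V)] : P {ω | U ω = V ω} = 0 := by
  have hD : MeasurableSet {p : ℝ × ℝ | p.1 = p.2} := measurableSet_eq_fun measurable_fst measurable_snd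
  have h1 : P {ω | U ω = V ω} = P.map (fun ω => (U ω, V ω)) {p | p.1 = p.2} := by
    rw [Measure.map_apply (hU.prodMk hV) hD]; rfl
  have : IsProbabilityMeasure (P.map V) := Measure.isProbabilityMeasure_map hV.aemeasurable
  rw [h1, (indepFun_iff_map_prod_eq_prod_map_map hU.aemeasurable hV.aemeasurable).1 h,
    Measure.prod_apply hD]
  have h2 : ∀ u : ℝ, Prod.mk u ⁻¹' {p : ℝ × ℝ | p.1 = p.2} = {u} := fun u => by
    ext v; simp [eq_comm]
  simp [h2]

/-- After a positive time `α`, the running maximum of `f - w - σ b` is the sum of a Gaussian variable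
and of an independent one, so it has no atoms: it is not equal to a given level `y`. -/
theorem measure_touch_after {b : ℝ≥0 → Ω → ℝ} (hb : IsPreBrownianReal b P)
    (hbm : ∀ r, Measurable (b r)) (hbc : ∀ ω, Continuous fun r => b r ω) {σ : ℝ} (hσ : σ ≠ 0)
    {w f : ℝ≥0 → ℝ} (hw : Continuous w) (hf : IsFrontPath f) {α t : ℝ≥0} (hα : 0 < α) (y : ℝ) :
    P {ω | (∃ r, α ≤ r ∧ r ≤ t ∧ y + (σ * b r ω + w r) ≤ f r) ∧
      ∀ r, α ≤ r → r ≤ t → f r ≤ y + (σ * b r ω + w r)} = 0 := by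
  set T : ℕ → ℝ≥0 := fun n => min (TopologicalSpace.denseSeq ℝ≥0 n) (t - α) with hT
  set ψ : (ℝ≥0 → ℝ) → ℝ := fun p =>
    ((⨆ n, (f (α + T n) - (σ * p (T n) + w (α + T n)))) - y) / σ with hψ
  have hψm : Measurable ψ := by
    refine ((Measurable.iSup fun n => ?_).sub_const y).div_const σ
    fun_prop
  have hind : IndepFun (fun ω => ψ fun r => b (α + r) ω - b α ω) (b α) P :=
    (hb.indepFun_shift α).comp (φ := ψ) (ψ := fun p : Iic α → ℝ => p ⟨α, self_mem_Iic⟩) hψm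
      (measurable_pi_apply (X := fun _ : Iic α => ℝ) ⟨α, self_mem_Iic⟩)
  have : NullSingletonClass (P.map (b α)) := by
    rw [(hb.hasLaw_eval α).map_eq]
    exact nullSingletonClass_gaussianReal hα.ne'
  refine measure_mono_null ?_ (measure_eq_of_indepFun_of_nullSingleton
    (hψm.comp (measurable_pi_lambda _ fun r => (hbm _).sub (hbm _))) (hbm α) hind)
  rintro ω ⟨⟨r, hαr, hrt, hr⟩, hno⟩
  have hfα : IsFrontPath fun q => f (α + q) := by
    refine ⟨fun p q h => hf.mono (by gcongr), fun q => ?_⟩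
    exact (hf.rightCont (α + q)).comp (t := Ici (α + q)) (by fun_prop)
      fun p hp => by simpa using hp
  have hxα : Continuous fun q => σ * (b (α + q) ω - b α ω) + w (α + q) := by
    have := hbc ω
    fun_prop
  have hhit : Hits (fun q => σ * (b (α + q) ω - b α ω) + w (α + q)) (fun q => f (α + q)) (t - α)
      (y + σ * b α ω) := by
    refine ⟨r - α, by gcongr, ?_⟩
    simp only [add_tsub_cancel_of_le hαr]
    linarith
  have hup : ∀ n, f (α + T n) - (σ * (b (α + T n) ω - b α ω) + w (α + T n)) ≤ y + σ * b α ω := by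
    intro n
    have h1 : α + T n ≤ t := by
      have : T n ≤ t - α := min_le_right _ _
      calc α + T n ≤ α + (t - α) := by gcongr
        _ = t := add_tsub_cancel_of_le (hαr.trans hrt)
    linarith [hno (α + T n) le_self_add h1]
  have hsup : (⨆ n, (f (α + T n) - (σ * (b (α + T n) ω - b α ω) + w (α + T n)))) =
      y + σ * b α ω := by
    refine le_antisymm (ciSup_le hup) (le_of_forall_lt fun z hz => ?_)
    obtain ⟨n, hn⟩ := (crosses_iff_exists_denseSeq hxα hfα).1 (hhit.crosses_of_lt hz)
    refine lt_of_lt_of_le ?_ (le_ciSup ⟨_, forall_mem_range.2 hup⟩ n)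
    simp only [hT]
    linarith
  change ((⨆ n, (f (α + T n) - (σ * (b (α + T n) ω - b α ω) + w (α + T n)))) - y) / σ = b α ω
  rw [hsup, add_sub_cancel_left, mul_div_cancel_left₀ _ hσ]

/-- A path that reaches a front almost surely crosses it as well, provided that the noise `σ b + w`
takes negative values immediately after time `0`. -/
theorem measure_hits_not_crosses {b : ℝ≥0 → Ω → ℝ} (hb : IsPreBrownianReal b P)
    (hbm : ∀ r, Measurable (b r)) (hbc : ∀ ω, Continuous fun r => b r ω) {σ : ℝ} (hσ : σ ≠ 0)
    {w f : ℝ≥0 → ℝ} (hw : Continuous w) (hf : IsFrontPath f)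
    (h0 : ∀ ω, σ * b 0 ω + w 0 = 0)
    (hneg : ∀ ε > 0, P {ω | ∀ r ≤ ε, 0 ≤ σ * b r ω + w r} = 0) {t : ℝ≥0} (ht : 0 < t) (y : ℝ) :
    P {ω | Hits (fun r => σ * b r ω + w r) f t y ∧
      ¬ Crosses (fun r => σ * b r ω + w r) f t y} = 0 := by
  refine measure_mono_null (t := {ω | ∀ r ≤ t, 0 ≤ σ * b r ω + w r} ∪
    ⋃ k : ℕ, {ω | (∃ r, t / (k + 1) ≤ r ∧ r ≤ t ∧ y + (σ * b r ω + w r) ≤ f r) ∧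
      ∀ r, t / (k + 1) ≤ r → r ≤ t → f r ≤ y + (σ * b r ω + w r)}) ?_ ?_
  · rintro ω ⟨⟨r, hrt, hr⟩, hno⟩
    have hno' : ∀ q ≤ t, f q ≤ y + (σ * b q ω + w q) := by simpa [Crosses] using hno
    rcases eq_zero_or_pos r with rfl | hr0
    · left
      intro q hq
      have := hf.mono (zero_le (a := q))
      linarith [hno' q hq, h0 ω]
    · right
      obtain ⟨k, hk⟩ := exists_nat_gt (t / r)
      refine mem_iUnion.2 ⟨k, ⟨r, ?_, hrt, hr⟩, fun q _ hq => hno' q hq⟩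
      rw [div_le_iff₀ (by positivity)]
      rw [div_lt_iff₀ hr0] at hk
      calc t ≤ k * r := hk.le
        _ ≤ r * (k + 1) := by rw [mul_comm]; gcongr; exact le_self_add
  · exact measure_union_null (hneg t ht) (measure_iUnion_null fun k =>
      measure_touch_after hb hbm hbc hσ hw hf (by positivity) y)

/-- Along a sequence `u` of rapidly growing times, `σ B` is infinitely often below `-√u`: by the second
Borel-Cantelli lemma its independent increments are infinitely often well below that level, and by
the first one they eventually dominate the position before the increment. -/
theorem ae_frequently_lt_neg_sqrt {B : ℝ≥0 → Ω → ℝ} (hB : IsPreBrownianReal B P)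
    (hBm : ∀ r, Measurable (B r)) {σ : ℝ} (hσ : σ ≠ 0) {u : ℕ → ℝ≥0} (hu0 : ∀ k, 0 < u k)
    (hu : ∀ k, 4 ^ (k + 1) * u k ≤ u (k + 1)) :
    ∀ᵐ ω ∂P, ∃ᶠ k in atTop, σ * B (u k) ω < - √(u k) := by
  have hu4 : ∀ k, 4 * u k ≤ u (k + 1) := fun k =>
    le_trans (by gcongr; exact le_self_pow (by norm_num) (by simp)) (hu k)
  have hmono : Monotone u := monotone_nat_of_le_succ fun k =>
    le_trans (le_mul_of_one_le_left zero_le (by norm_num)) (hu4 k)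
  set s : ℕ → ℝ := fun k => √(u (k + 1) - u k) with hs
  have hspos : ∀ k, 0 < s k := fun k => by
    have := hu4 k
    have h0 := hu0 k
    have h1 : (4 : ℝ) * u k ≤ u (k + 1) := by exact_mod_cast this
    have h2 : (0 : ℝ) < u k := by exact_mod_cast h0
    exact Real.sqrt_pos.2 (by linarith)
  have hsle : ∀ k, √(u (k + 1)) ≤ 2 * s k := fun k => by
    have h1 : (4 : ℝ) * u k ≤ u (k + 1) := by exact_mod_cast hu4 k
    rw [Real.sqrt_le_left (by have := hspos k; positivity), mul_pow,
      Real.sq_sqrt (by have : (0:ℝ) ≤ u k := (u k).2; linarith)]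
    have : (0:ℝ) ≤ u k := (u k).2
    linarith
  -- The increment over `[u k, u (k + 1)]` is four standard deviations below `0`, up to the factor `σ`.
  -- These events are independent and, by scaling, all have the same positive probability.
  set A : ℕ → Set Ω := fun k => {ω | σ * (B (u (k + 1)) ω - B (u k) ω) < - 4 * s k} with hA
  have hAm : ∀ k, MeasurableSet (A k) := fun k =>
    measurableSet_lt ((((hBm _).sub (hBm _))).const_mul σ) measurable_const
  have hAind : iIndepSet A P := by
    have h1 := hB.hasIndepIncrements.nat hmono
    rw [iIndepSet_iff_meas_biInter hAm]
    intro S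
    exact h1.measure_inter_preimage_eq_mul S
      (sets := fun k => {z : ℝ | σ * z < - 4 * s k}) fun k _ =>
        measurableSet_lt (measurable_id.const_mul σ) measurable_const
  have hAp : ∀ k, P (A k) = gaussianReal 0 1 {z | σ * z < -4} := by
    intro k
    have hlaw := hB.hasLaw_sub (u (k + 1)) (u k)
    have hv : (nndist (u (k + 1)).1 (u k).1 : ℝ≥0) = .mk (s k ^ 2) (sq_nonneg _) * 1 := by
      ext
      have h1 : (u k : ℝ) ≤ u (k + 1) := by exact_mod_cast hmono (Nat.le_succ k)
      simp only [mul_one, hs, coe_nndist, Real.dist_eq, NNReal.coe_mk]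
      rw [Real.sq_sqrt (by linarith)]
      exact abs_of_nonneg (sub_nonneg.2 h1)
    have hmap := gaussianReal_map_const_mul (μ := 0) (v := 1) (s k)
    rw [mul_zero, ← hv] at hmap
    have hms : ∀ c : ℝ, MeasurableSet {z : ℝ | σ * z < c} := fun c =>
      measurableSet_lt (measurable_id.const_mul σ) measurable_const
    have h1 : P (A k) = P.map (B (u (k + 1)) - B (u k)) {z | σ * z < - 4 * s k} := by
      rw [Measure.map_apply ((hBm _).sub (hBm _)) (hms _)]; rfl
    rw [h1, hlaw.map_eq, ← hmap, Measure.map_apply (by fun_prop) (hms _)]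
    congr 1
    ext z
    simp only [mem_preimage, mem_ofPred_eq]
    rw [show σ * (s k * z) = (σ * z) * s k by ring, mul_lt_mul_iff_left₀ (hspos k)]
  have hpos : gaussianReal 0 1 {z | σ * z < -4} ≠ 0 := by
    intro h
    have h1 := gaussianReal_absolutelyContinuous' 0 (one_ne_zero (α := ℝ≥0)) h
    have hopen : IsOpen {z : ℝ | σ * z < -4} := isOpen_lt (by fun_prop) continuous_const
    refine (hopen.measure_pos volume ⟨-5 / σ, ?_⟩).ne' h1
    simp only [mem_ofPred_eq]
    rw [mul_div_cancel₀ _ hσ]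
    norm_num
  have hAinf : P (limsup A atTop) = 1 := by
    refine measure_limsup_eq_one hAm hAind ?_
    simp_rw [hAp]
    exact ENNReal.tsum_const_eq_top_of_ne_zero hpos
  have hAae : ∀ᵐ ω ∂P, ∃ᶠ k in atTop, ω ∈ A k := by
    have h1 : ∀ᵐ ω ∂P, ω ∈ limsup A atTop :=
      (mem_ae_iff_prob_eq_one (MeasurableSet.measurableSet_limsup hAm)).2 hAinf
    filter_upwards [h1] with ω hω
    exact mem_limsup_iff_frequently_mem.1 hω
  -- By Chebyshev's inequality, the position before an increment is eventually of smaller order.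
  set C : ℕ → Set Ω := fun k => {ω | √(u (k + 1)) ≤ |σ * B (u k) ω|} with hC
  have hCp : ∀ k, P (C k) ≤ ENNReal.ofReal (σ ^ 2 * (1 / 4) ^ (k + 1)) := by
    intro k
    have hL2 : MemLp (fun ω => σ * B (u k) ω) 2 P :=
      (hB.isGaussianProcess.hasGaussianLaw_eval (u k)).memLp_two.const_mul σ
    have hpos1 : (0 : ℝ) < u (k + 1) := by exact_mod_cast hu0 (k + 1)
    have h1 := meas_ge_le_variance_div_sq hL2 (c := √(u (k + 1))) (Real.sqrt_pos.2 hpos1)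
    rw [integral_const_mul, hB.integral_eval, mul_zero, variance_const_mul,
      (hB.hasLaw_eval (u k)).variance_eq, variance_id_gaussianReal, Real.sq_sqrt hpos1.le] at h1
    simp only [sub_zero] at h1
    refine h1.trans (ENNReal.ofReal_le_ofReal ?_)
    have h2 : (4 : ℝ) ^ (k + 1) * u k ≤ u (k + 1) := by exact_mod_cast hu k
    rw [div_le_iff₀ hpos1, one_div, inv_pow, mul_assoc]
    gcongr
    rw [← div_eq_inv_mul, le_div_iff₀ (by positivity)]
    linarith
  have hCae : ∀ᵐ ω ∂P, ∀ᶠ k in atTop, ω ∉ C k := by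
    refine ae_eventually_notMem (ne_top_of_le_ne_top ?_ (ENNReal.tsum_le_tsum hCp))
    refine Summable.tsum_ofReal_ne_top (Summable.mul_left _ ?_)
    exact (summable_nat_add_iff 1).2
      (summable_geometric_of_lt_one (r := (1 / 4 : ℝ)) (by norm_num) (by norm_num))
  filter_upwards [hAae, hCae] with ω h1 h2
  refine (tendsto_add_atTop_nat 1).frequently ((h1.and_eventually h2).mono fun k ⟨hk1, hk2⟩ => ?_)
  simp only [hA, hC, mem_ofPred_eq, not_le] at hk1 hk2
  have h3 := (abs_lt.1 hk2).2
  have h4 := hsle k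
  rw [mul_sub] at hk1
  linarith

/-- For almost every path of `W`, the path `σ B + θ W` becomes negative immediately after time `0`,
almost surely with respect to `B`. By time inversion this is a statement about large times; one
first chooses, depending on `W`, rapidly growing times at which `θ W` is not too large. -/
theorem ae_measure_forall_nonneg_eq_zero {B W : ℝ≥0 → Ω → ℝ} (hB : IsPreBrownianReal B P)
    (hBm : ∀ r, Measurable (B r)) (hW : IsPreBrownianReal W P) (hWm : ∀ r, Measurable (W r))
    {σ : ℝ} (hσ : σ ≠ 0) (θ : ℝ) :
    ∀ᵐ ω ∂P, ∀ ε > 0, P {ω' | ∀ r ≤ ε, 0 ≤ σ * B r ω' + θ * W r ω} = 0 := by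
  set u : ℕ → ℝ≥0 := fun k => 4 ^ (k ^ 2) with hu
  have hu0 : ∀ k, 0 < u k := fun k => by positivity
  have hustep : ∀ k, 4 ^ (k + 1) * u k ≤ u (k + 1) := fun k => by
    simp only [hu, ← pow_add]
    exact pow_le_pow_right₀ (by norm_num) (by nlinarith)
  have humono : Monotone u := fun i j hij =>
    pow_le_pow_right₀ (by norm_num) (Nat.pow_le_pow_left hij 2)
  have hutop : Tendsto (fun k => 1 / u k) atTop (𝓝 0) := by
    have h1 : Tendsto (fun k : ℕ => (1 / 4 : ℝ≥0) ^ k) atTop (𝓝 0) :=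
      NNReal.tendsto_pow_atTop_nhds_zero_of_lt_one (by
        rw [div_lt_one (by norm_num)]; norm_num)
    refine tendsto_of_tendsto_of_tendsto_of_le_of_le tendsto_const_nhds h1 (fun _ => zero_le)
      fun k => ?_
    simp only [hu, one_div, inv_pow]
    gcongr
    · norm_num
    · nlinarith
  have hWfreq : ∀ᵐ ω ∂P, ∃ᶠ k in atTop, θ * (u k * W (1 / u k) ω) ≤ √(u k) := by
    rcases eq_or_ne θ 0 with rfl | hθ
    · exact ae_of_all _ fun ω => Frequently.of_forall fun k => by simp
    · filter_upwards [ae_frequently_lt_neg_sqrt hW.inv (fun r => (hWm _).const_mul _) hθ hu0 hustep]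
        with ω hω
      exact hω.mono fun k hk => hk.le.trans ((neg_nonpos.2 (Real.sqrt_nonneg _)).trans
        (Real.sqrt_nonneg _))
  filter_upwards [hWfreq] with ω hω ε hε
  obtain ⟨φ, hφ, hφW⟩ := extraction_of_frequently_atTop hω
  have hstep' : ∀ k, 4 ^ (k + 1) * u (φ k) ≤ u (φ (k + 1)) := fun k =>
    calc 4 ^ (k + 1) * u (φ k) ≤ 4 ^ (φ k + 1) * u (φ k) := by
          gcongr
          · norm_num
          · exact hφ.le_apply
      _ ≤ u (φ k + 1) := hustep _
      _ ≤ u (φ (k + 1)) := humono (hφ (Nat.lt_succ_self k))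
  have hBfreq := ae_frequently_lt_neg_sqrt hB.inv (fun r => (hBm _).const_mul _) hσ
    (u := u ∘ φ) (fun k => hu0 _) hstep'
  have hnot : ∀ᵐ ω' ∂P, ¬ ∀ r ≤ ε, 0 ≤ σ * B r ω' + θ * W r ω := by
    filter_upwards [hBfreq] with ω' hω' hall
    have hsmall : ∀ᶠ k in atTop, 1 / u (φ k) < ε :=
      (hutop.comp hφ.tendsto_atTop).eventually_lt_const hε
    obtain ⟨k, hk1, hk2⟩ := (hω'.and_eventually hsmall).exists
    have h1 := hall _ hk2.le
    have h2 := hφW k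
    have h3 : (0 : ℝ) < u (φ k) := by exact_mod_cast hu0 (φ k)
    have h4 := mul_nonneg h3.le h1
    simp only [Function.comp_apply] at hk1
    linarith
  rw [ae_iff] at hnot
  simpa only [not_not] using hnot

end Brownian
/-! ### Independence and conditional probabilities -/

section Independence

variable {Ω : Type*} [mΩ : MeasurableSpace Ω] {P : Measure Ω} [IsProbabilityMeasure P]

theorem indepFun_prodMk_of_indepFun {E F G : Type*} [MeasurableSpace E] [MeasurableSpace F]
    [MeasurableSpace G] {X : Ω → E} {Y : Ω → F} {Z : Ω → G} (hX : Measurable X) (hY : Measurable Y)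
    (hZ : Measurable Z) (hYZ : IndepFun Y Z P) (h : IndepFun X (fun ω => (Y ω, Z ω)) P) :
    IndepFun (fun ω => (X ω, Z ω)) Y P := by
  have hXZ : IndepFun X Z P := h.comp (φ := id) measurable_id measurable_snd
  have := Measure.isProbabilityMeasure_map (μ := P) hX.aemeasurable
  have := Measure.isProbabilityMeasure_map (μ := P) hY.aemeasurable
  have := Measure.isProbabilityMeasure_map (μ := P) hZ.aemeasurable
  rw [indepFun_iff_map_prod_eq_prod_map_map (by fun_prop) (by fun_prop)] at hYZ h hXZ ⊢
  have hmp : MeasurePreserving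
      (fun p : E × (F × G) => (MeasurableEquiv.prodAssoc (α := E) (β := G) (γ := F)).symm
        (p.1, p.2.swap))
      ((P.map X).prod ((P.map Y).prod (P.map Z))) (((P.map X).prod (P.map Z)).prod (P.map Y)) :=
    ((measurePreserving_prodAssoc (P.map X) (P.map Z) (P.map Y)).symm _).comp
      ((MeasurePreserving.id _).prod Measure.measurePreserving_swap)
  rw [hXZ, ← hmp.map_eq, ← hYZ, ← h, Measure.map_map hmp.measurable (by fun_prop)]
  rfl

omit [IsProbabilityMeasure P] in
/-- Independence is not affected by null sets. -/
theorem indep_eventuallyMeasurableSpace {m₁ m₂ : MeasurableSpace Ω} (h : Indep m₁ m₂ P) :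
    Indep (eventuallyMeasurableSpace m₁ (ae P)) (eventuallyMeasurableSpace m₂ (ae P)) P := by
  rw [Indep_iff] at h ⊢
  rintro A B ⟨A', hA', hAA⟩ ⟨B', hB', hBB⟩
  rw [measure_congr (hAA.inter hBB), measure_congr hAA, measure_congr hBB, h A' B' hA' hB']

/-- The conditional probability of an event that depends on `X` and on an independent variable `Y`
is obtained by freezing the value of `X`. -/
theorem measureReal_ae_eq_condExp_comap {E F : Type*} [mE : MeasurableSpace E] [MeasurableSpace F]
    {X : Ω → E} {Y : Ω → F} (hX : Measurable X) (hY : Measurable Y) (h : IndepFun X Y P)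
    {G : Set (E × F)} (hG : MeasurableSet G) :
    (fun ω => P.real {ω' | (X ω, Y ω') ∈ G}) =ᵐ[P] P⟦{ω | (X ω, Y ω) ∈ G}|mE.comap X⟧ := by
  have hfib : ∀ e, P {ω' | (e, Y ω') ∈ G} = P.map Y (Prod.mk e ⁻¹' G) := fun e => by
    rw [Measure.map_apply hY (measurable_prodMk_left hG)]; rfl
  have := Measure.isProbabilityMeasure_map (μ := P) hY.aemeasurable
  have hqE : Measurable fun e => P {ω' | (e, Y ω') ∈ G} := by
    simp_rw [hfib]; exact measurable_measure_prodMk_left hG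
  have hq : Measurable[mE.comap X] fun ω => P.real {ω' | (X ω, Y ω') ∈ G} :=
    hqE.ennreal_toReal.comp (comap_measurable X)
  have hA : MeasurableSet {ω | (X ω, Y ω) ∈ G} := (hX.prodMk hY) hG
  have hint : Integrable (fun ω => P.real {ω' | (X ω, Y ω') ∈ G}) P :=
    Integrable.of_bound (hq.mono hX.comap_le le_rfl).aestronglyMeasurable 1
      (ae_of_all _ fun ω => by
        rw [Real.norm_of_nonneg measureReal_nonneg]; exact measureReal_le_one)
  refine ae_eq_condExp_of_forall_setIntegral_eq hX.comap_le
    ((integrable_const _).indicator hA) (fun _ _ _ => hint.integrableOn) ?_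
    hq.aestronglyMeasurable
  rintro _ ⟨D, hD, rfl⟩ -
  have hmap := (indepFun_iff_map_prod_eq_prod_map_map hX.aemeasurable hY.aemeasurable).1 h
  have hmeas : P ({ω | (X ω, Y ω) ∈ G} ∩ X ⁻¹' D) =
      ∫⁻ ω in X ⁻¹' D, P {ω' | (X ω, Y ω') ∈ G} ∂P := by
    have h1 : P ({ω | (X ω, Y ω) ∈ G} ∩ X ⁻¹' D) =
        P.map (fun ω => (X ω, Y ω)) (G ∩ Prod.fst ⁻¹' D) := by
      rw [Measure.map_apply (hX.prodMk hY) (hG.inter (measurable_fst hD))]; rfl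
    rw [h1, hmap, Measure.prod_apply (hG.inter (measurable_fst hD)), ← setLIntegral_map hD hqE hX,
      ← lintegral_indicator hD]
    refine lintegral_congr fun e => ?_
    by_cases he : e ∈ D
    · rw [indicator_of_mem he, hfib]
      congr 1
      ext z
      simp [he]
    · rw [indicator_of_notMem he]
      convert measure_empty (μ := P.map Y)
      ext z
      simp [he]
  rw [setIntegral_indicator hA, setIntegral_const, smul_eq_mul, mul_one, inter_comm]
  simp only [measureReal_def]
  rw [hmeas]
  exact integral_toReal (hqE.comp hX).aemeasurable (ae_of_all _ fun _ => measure_lt_top _ _)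

end Independence

section Measurability

/-- Measurability of an integral against a random finite measure. -/
theorem measurable_integral_random_measure {E : Type*} [MeasurableSpace E] {ν : E → Measure ℝ}
    (hν : Measurable ν) (hfin : ∀ e, IsFiniteMeasure (ν e)) {h : E × ℝ → ℝ} (hh : Measurable h) :
    Measurable fun e => ∫ y, h (e, y) ∂(ν e) := by
  have hm : Measurable fun e => 1 + ν e univ :=
    ((Measure.measurable_coe MeasurableSet.univ).comp hν).const_add 1
  -- Dividing by the total mass gives a kernel with a uniform bound on its mass.
  let κ : Kernel E ℝ := ⟨fun e => (1 + ν e univ)⁻¹ • ν e, by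
    refine Measure.measurable_of_measurable_coe _ fun s hs => ?_
    simp only [Measure.smul_apply, smul_eq_mul]
    exact hm.inv.mul ((Measure.measurable_coe hs).comp hν)⟩
  have hne : ∀ e, 1 + ν e univ ≠ 0 := fun e => by positivity
  have htop : ∀ e, 1 + ν e univ ≠ ∞ := fun e => by
    have := hfin e
    exact ENNReal.add_ne_top.2 ⟨ENNReal.one_ne_top, measure_ne_top _ _⟩
  have : IsFiniteKernel κ := ⟨1, ENNReal.one_lt_top, fun e => by
    change (1 + ν e univ)⁻¹ * ν e univ ≤ 1
    rw [← ENNReal.div_eq_inv_mul]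
    exact ENNReal.div_le_of_le_mul (by rw [one_mul]; exact le_add_self)⟩
  have hκ : ∀ e, ν e = (1 + ν e univ) • κ e := fun e => by
    change ν e = (1 + ν e univ) • ((1 + ν e univ)⁻¹ • ν e)
    rw [smul_smul, ENNReal.mul_inv_cancel (hne e) (htop e), one_smul]
  have h1 : ∀ e, ∫ y, h (e, y) ∂(ν e) = (1 + ν e univ).toReal * ∫ y, h (e, y) ∂(κ e) := fun e => by
    conv_lhs => rw [hκ e]
    rw [integral_smul_measure, smul_eq_mul]
  simp_rw [h1]
  exact hm.ennreal_toReal.mul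
    (StronglyMeasurable.integral_kernel_prod_right (κ := κ) (f := fun e y => h (e, y))
      hh.stronglyMeasurable).measurable

variable {Ω : Type*} [MeasurableSpace Ω] {P : Measure Ω} [IsProbabilityMeasure P]
  {E : Type*} [MeasurableSpace E] {b : ℝ≥0 → Ω → ℝ} {w f : ℝ≥0 → E → ℝ} {σ θ : ℝ} {t : ℝ≥0}
  (hbm : ∀ r, Measurable (b r)) (hbc : ∀ ω, Continuous fun r => b r ω)
  (hw : ∀ r ≤ t, Measurable (w r)) (hwc : ∀ e, Continuous fun r => w r e)
  (hf : ∀ r ≤ t, Measurable (f r)) (hfc : ∀ e, IsFrontPath fun r => f r e)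

include hbm hbc hw hwc hf hfc in
theorem measurable_hitProb_prod : Measurable fun p : E × ℝ =>
    hitProb P (fun r ω => σ * b r ω + θ * w r p.1) (fun r => f r p.1) t p.2 := by
  have hset : MeasurableSet {q : (E × ℝ) × Ω |
      Hits (fun r => σ * b r q.2 + θ * w r q.1.1) (fun r => f r q.1.1) t q.1.2} := by
    refine measurableSet_hits (x := fun r (q : (E × ℝ) × Ω) => σ * b r q.2 + θ * w r q.1.1)
      (f := fun r (q : (E × ℝ) × Ω) => f r q.1.1) (y := fun q => q.1.2)
      (fun q => ?_) (fun q => hfc _) (fun r hr => ?_) (fun r hr => ?_) (by fun_prop)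
    · have := hbc q.2
      have := hwc q.1.1
      fun_prop
    · have := hbm r
      have := hw r hr
      fun_prop
    · exact (hf r hr).comp measurable_fst.fst
  exact (measurable_measure_prodMk_left hset).ennreal_toReal

include hbm hbc hw hwc hf hfc in
theorem measurable_frontOp {ν : E → Measure ℝ} (hν : Measurable ν)
    (hfin : ∀ e, IsFiniteMeasure (ν e)) {a : E → ℝ} (ha : Measurable a) (c : ℝ) :
    Measurable fun e =>
      frontOp P (fun r ω => σ * b r ω + θ * w r e) (ν e) (a e) c (fun r => f r e) t := by
  have hset : MeasurableSet {p : E × ℝ | a p.1 ≤ p.2} :=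
    measurableSet_le (ha.comp measurable_fst) measurable_snd
  have h1 := measurable_integral_random_measure hν hfin
    ((measurable_hitProb_prod (P := P) (σ := σ) (θ := θ) hbm hbc hw hwc hf hfc).indicator hset)
  have h2 : ∀ e, ∫ y, {p : E × ℝ | a p.1 ≤ p.2}.indicator (fun p : E × ℝ =>
      hitProb P (fun r ω => σ * b r ω + θ * w r p.1) (fun r => f r p.1) t p.2) (e, y) ∂(ν e) =
      ∫ y in Ici (a e), hitProb P (fun r ω => σ * b r ω + θ * w r e) (fun r => f r e) t y ∂(ν e) :=
    fun e => integral_indicator (s := Ici (a e)) measurableSet_Ici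
  simp_rw [h2] at h1
  exact ha.add (h1.const_mul c)

end Measurability

namespace Setting

/-! ### The noise, with all paths continuous -/

section Noise

variable {Ω : Type*} [MeasurableSpace Ω] {μ : Measure Ω} (S : Setting Ω μ)

/-- A measurable null event off which the paths of `B` and `W` are continuous and start at `0`. -/
def badSet : Set Ω := toMeasurable μ {ω | ¬ ((Continuous fun t => S.B t ω) ∧
  (Continuous fun t => S.W t ω) ∧ S.B 0 ω = 0 ∧ S.W 0 ω = 0)}

theorem measure_badSet : μ S.badSet = 0 := by
  rw [badSet, measure_toMeasurable]
  have h : ∀ᵐ ω ∂μ, (Continuous fun t => S.B t ω) ∧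
      (Continuous fun t => S.W t ω) ∧ S.B 0 ω = 0 ∧ S.W 0 ω = 0 := by
    filter_upwards [S.isBrownian_B.cont, S.isBrownian_W.cont,
      S.isBrownian_B.eval_zero_ae_eq_zero, S.isBrownian_W.eval_zero_ae_eq_zero] with ω h1 h2 h3 h4
    exact ⟨h1, h2, h3, h4⟩
  exact h

theorem measurableSet_badSet : MeasurableSet S.badSet := measurableSet_toMeasurable _ _

theorem measurableSet_nullSigma_badSet : MeasurableSet[nullSigma μ] S.badSet :=
  MeasurableSpace.measurableSet_generateFrom ⟨S.measurableSet_badSet, S.measure_badSet⟩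

theorem ae_notMem_badSet : ∀ᵐ ω ∂μ, ω ∉ S.badSet := measure_eq_zero_iff_ae_notMem.1 S.measure_badSet

theorem good_of_notMem {ω : Ω} (h : ω ∉ S.badSet) : (Continuous fun t => S.B t ω) ∧
    (Continuous fun t => S.W t ω) ∧ S.B 0 ω = 0 ∧ S.W 0 ω = 0 := by
  by_contra hn
  exact h (subset_toMeasurable μ _ hn)

/-- The Brownian motion `B`, set to `0` off the event of continuity. -/
noncomputable def B' (t : ℝ≥0) : Ω → ℝ := S.badSetᶜ.indicator (S.B t)

/-- The Brownian motion `W`, set to `0` off the event of continuity. -/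
noncomputable def W' (t : ℝ≥0) : Ω → ℝ := S.badSetᶜ.indicator (S.W t)

theorem B'_eq {ω : Ω} (h : ω ∉ S.badSet) (t : ℝ≥0) : S.B' t ω = S.B t ω := indicator_of_mem h _

theorem W'_eq {ω : Ω} (h : ω ∉ S.badSet) (t : ℝ≥0) : S.W' t ω = S.W t ω := indicator_of_mem h _

theorem continuous_B' (ω : Ω) : Continuous fun t => S.B' t ω := by
  by_cases h : ω ∈ S.badSet
  · simpa [B', h] using continuous_const
  · simpa only [S.B'_eq h] using (S.good_of_notMem h).1

theorem continuous_W' (ω : Ω) : Continuous fun t => S.W' t ω := by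
  by_cases h : ω ∈ S.badSet
  · simpa [W', h] using continuous_const
  · simpa only [S.W'_eq h] using (S.good_of_notMem h).2.1

theorem B'_zero (ω : Ω) : S.B' 0 ω = 0 := by
  by_cases h : ω ∈ S.badSet
  · simp [B', h]
  · simpa only [S.B'_eq h] using (S.good_of_notMem h).2.2.1

theorem W'_zero (ω : Ω) : S.W' 0 ω = 0 := by
  by_cases h : ω ∈ S.badSet
  · simp [W', h]
  · simpa only [S.W'_eq h] using (S.good_of_notMem h).2.2.2

theorem measurable_B' (t : ℝ≥0) : Measurable (S.B' t) :=
  (S.measurable_B t).indicator S.measurableSet_badSet.compl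

theorem measurable_W' (t : ℝ≥0) : Measurable (S.W' t) :=
  (S.measurable_W t).indicator S.measurableSet_badSet.compl

theorem isPreBrownianReal_B' : IsPreBrownianReal S.B' μ :=
  S.isBrownian_B.toIsPreBrownianReal.congr fun t => by
    filter_upwards [S.ae_notMem_badSet] with ω h using (S.B'_eq h t).symm

theorem isPreBrownianReal_W' : IsPreBrownianReal S.W' μ :=
  S.isBrownian_W.toIsPreBrownianReal.congr fun t => by
    filter_upwards [S.ae_notMem_badSet] with ω h using (S.W'_eq h t).symm

/-- The volatility `√(2κ - θ²)` of the idiosyncratic noise. -/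
noncomputable def sig : ℝ := √(2 * S.kap - S.theta ^ 2)

theorem sig_ne_zero : S.sig ≠ 0 := by
  have h1 := S.abs_theta_lt
  have h2 : S.theta ^ 2 < 2 * S.kap := by
    rw [← sq_abs]
    exact (Real.lt_sqrt (abs_nonneg _)).1 h1
  exact (Real.sqrt_pos.2 (sub_pos.2 h2)).ne'

/-- The noise `X⁰` with the common noise `W` frozen at `ω`, as a process on a copy of `Ω`. -/
noncomputable def noise (ω : Ω) (t : ℝ≥0) (ω' : Ω) : ℝ := S.sig * S.B' t ω' + S.theta * S.W' t ω

theorem continuous_noise (ω ω' : Ω) : Continuous fun t => S.noise ω t ω' :=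
  ((S.continuous_B' ω').const_mul _).add ((S.continuous_W' ω).const_mul _)

theorem measurable_noise (ω : Ω) (t : ℝ≥0) : Measurable (S.noise ω t) :=
  ((S.measurable_B' t).const_mul _).add_const _

theorem noise_zero (ω ω' : Ω) : S.noise ω 0 ω' = 0 := by simp [noise, B'_zero, W'_zero]

/-! ### The filtration -/

/-- The filtration before taking right limits. -/
noncomputable abbrev rawFilt : Filtration ℝ≥0 ‹MeasurableSpace Ω› :=
  Filtration.natural S.W (fun t => (S.measurable_W t).stronglyMeasurable) ⊔
    Filtration.const ℝ≥0 (S.initSigma ⊔ nullSigma μ) S.initSigma_sup_nullSigma_le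

theorem rawFilt_le_filt (t : ℝ≥0) : S.rawFilt t ≤ S.filt t := S.rawFilt.le_rightCont t

theorem filt_le_rawFilt {t u : ℝ≥0} (h : t < u) : S.filt t ≤ S.rawFilt u := by
  change S.rawFilt.rightCont t ≤ _
  rw [Filtration.rightCont_eq]
  exact iInf₂_le u h

theorem initSigma_sup_nullSigma_le_filt (t : ℝ≥0) : S.initSigma ⊔ nullSigma μ ≤ S.filt t :=
  le_trans le_sup_right (S.rawFilt_le_filt t)

theorem filt_le_filtInfty (t : ℝ≥0) : S.filt t ≤ S.filtInfty := le_iSup (fun t => S.filt t) t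

theorem measurable_filt_W' {r t : ℝ≥0} (h : r ≤ t) : Measurable[S.filt t] (S.W' r) := by
  have h1 : Measurable[S.filt t] (S.W r) := by
    refine (comap_measurable (S.W r)).mono (le_trans ?_ (S.rawFilt_le_filt t)) le_rfl
    exact le_trans (le_iSup₂_of_le r h le_rfl) (le_sup_left (b := S.initSigma ⊔ nullSigma μ))
  exact h1.indicator (((le_sup_right (a := S.initSigma)).trans
    (S.initSigma_sup_nullSigma_le_filt t)) _ S.measurableSet_nullSigma_badSet).compl

theorem measurable_filt_nu0 (t : ℝ≥0) : Measurable[S.filt t] S.nu0 :=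
  (comap_measurable S.nu0).mono ((le_sup_left.trans le_sup_left).trans
    (S.initSigma_sup_nullSigma_le_filt t)) le_rfl

theorem measurable_filt_s0 (t : ℝ≥0) : Measurable[S.filt t] S.s0 :=
  (comap_measurable S.s0).mono ((le_sup_right.trans le_sup_left).trans
    (S.initSigma_sup_nullSigma_le_filt t)) le_rfl

/-- Up to null sets, `F_∞` is generated by the initial data and `W`. -/
theorem filtInfty_le : S.filtInfty ≤ eventuallyMeasurableSpace
    (MeasurableSpace.comap (fun ω => ((S.nu0 ω, S.s0 ω), fun t : ℝ≥0 => S.W t ω)) inferInstance)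
    (ae μ) := by
  set Y := fun ω => ((S.nu0 ω, S.s0 ω), fun t : ℝ≥0 => S.W t ω)
  have hY : Measurable[MeasurableSpace.comap Y inferInstance] Y := comap_measurable Y
  refine iSup_le fun t => ?_
  refine (S.filt_le_rawFilt (lt_add_one t)).trans (sup_le ?_ (sup_le ?_ ?_))
  · refine le_trans ?_ le_eventuallyMeasurableSpace
    refine iSup₂_le fun r _ => ?_
    exact Measurable.comap_le ((measurable_pi_apply r).comp (measurable_snd.comp hY))
  · refine le_trans (sup_le ?_ ?_) le_eventuallyMeasurableSpace
    · exact Measurable.comap_le (measurable_fst.comp (measurable_fst.comp hY))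
    · exact Measurable.comap_le (measurable_snd.comp (measurable_fst.comp hY))
  · refine MeasurableSpace.generateFrom_le fun N hN => ⟨∅, @MeasurableSet.empty _ (_), ?_⟩
    exact ae_eq_empty.2 hN.2

/-- The σ-algebra generated by the idiosyncratic Brownian motion. -/
noncomputable abbrev idioSigma : MeasurableSpace Ω :=
  MeasurableSpace.comap (fun ω (t : ℝ≥0) => S.B' t ω) inferInstance

theorem idioSigma_le : S.idioSigma ≤ ‹MeasurableSpace Ω› :=
  Measurable.comap_le (measurable_pi_lambda _ S.measurable_B')

theorem measurable_idioSigma_B' (t : ℝ≥0) : Measurable[S.idioSigma] (S.B' t) :=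
  (measurable_pi_apply t).comp (comap_measurable fun ω (t : ℝ≥0) => S.B' t ω)

theorem filtInfty_le_measurableSpace : S.filtInfty ≤ ‹MeasurableSpace Ω› :=
  iSup_le fun t => S.filt.le t

theorem indep_filtInfty_idioSigma [IsProbabilityMeasure μ] : Indep S.filtInfty S.idioSigma μ := by
  have h1 : IndepFun (fun ω => ((S.nu0 ω, S.s0 ω), fun t : ℝ≥0 => S.W t ω))
      (fun ω (t : ℝ≥0) => S.B t ω) μ :=
    indepFun_prodMk_of_indepFun (S.measurable_nu0.prodMk S.measurable_s0)
      (measurable_pi_lambda _ S.measurable_B) (measurable_pi_lambda _ S.measurable_W)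
      S.indep_B_W S.indep_init
  have h2 : IndepFun (fun ω => ((S.nu0 ω, S.s0 ω), fun t : ℝ≥0 => S.W t ω))
      (fun ω (t : ℝ≥0) => S.B' t ω) μ := by
    refine h1.congr (ae_eq_refl _) ?_
    filter_upwards [S.ae_notMem_badSet] with ω h
    ext t
    exact (S.B'_eq h t).symm
  exact indep_of_indep_of_le_right (indep_of_indep_of_le_left
    (indep_eventuallyMeasurableSpace h2) S.filtInfty_le) le_eventuallyMeasurableSpace

end Noise

/-! ### The conditional hitting probabilities -/

/-- Two regular versions of a family of conditional probabilities agree off a single null set. -/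
theorem _root_.StefanMV.IsCondProbVersion.ae_eq_all {Ω : Type*} {m : MeasurableSpace Ω}
    [MeasurableSpace Ω] {μ : Measure Ω} {A : ℝ → Set Ω}
    {p q : ℝ → Ω → ℝ} (hp : IsCondProbVersion m μ A p) (hq : IsCondProbVersion m μ A q) :
    ∀ᵐ ω ∂μ, ∀ y, p y ω = q y ω := by
  have h : ∀ᵐ ω ∂μ, ∀ y : ℚ, p y ω = q y ω :=
    ae_all_iff.2 fun y => (hp.ae_eq y).trans (hq.ae_eq y).symm
  filter_upwards [h] with ω hω y
  have hlim : ∀ {p : ℝ → Ω → ℝ}, IsCondProbVersion m μ A p →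
      Tendsto (fun z => p z ω) (𝓝[Iio y ∩ range ((↑) : ℚ → ℝ)] y) (𝓝 (p y ω)) := fun hp =>
    (hp.leftCont ω y).mono_left (nhdsWithin_mono y fun z hz => mem_Iic.2 (le_of_lt hz.1))
  have : (𝓝[Iio y ∩ range ((↑) : ℚ → ℝ)] y).NeBot := by
    rw [← mem_closure_iff_nhdsWithin_neBot]
    have hsub := closure_minimal
      ((Rat.denseRange_cast (𝕜 := ℝ)).open_subset_closure_inter (isOpen_Iio (a := y))) isClosed_closure
    exact hsub (by rw [closure_Iio]; exact self_mem_Iic)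
  refine tendsto_nhds_unique (hlim hp) ((hlim hq).congr' ?_)
  filter_upwards [self_mem_nhdsWithin] with z hz
  obtain ⟨r, rfl⟩ := hz.2
  exact (hω r).symm

section Gamma

variable {Ω : Type*} {m : MeasurableSpace Ω} [MeasurableSpace Ω] {μ : Measure Ω} (S : Setting Ω μ)

theorem IsFront.isFrontPath {S : Setting Ω μ} {s : ℝ≥0 → Ω → ℝ} (hs : S.IsFront s) (ω : Ω) :
    IsFrontPath fun t => s t ω := ⟨hs.mono ω, hs.rightCont ω⟩

theorem IsFront.measurable {S : Setting Ω μ} {s : ℝ≥0 → Ω → ℝ} (hs : S.IsFront s) {r t : ℝ≥0}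
    (h : r ≤ t) : Measurable[S.filt t] (s r) := (hs.adapted r).mono (S.filt.mono h) le_rfl

theorem tau_le_iff {s : ℝ≥0 → Ω → ℝ} (hs : S.IsFront s) {ω : Ω} (hω : ω ∉ S.badSet) (y : ℝ)
    (t : ℝ≥0) : S.tau s y ω ≤ t ↔ Hits (fun r => S.noise ω r ω) (fun r => s r ω) t y := by
  have hX : ∀ r, S.X y r ω = y + S.noise ω r ω := fun r => by
    simp only [X, noise, sig, S.B'_eq hω, S.W'_eq hω]; ring
  refine ⟨fun h => ?_, fun ⟨r, hrt, hr⟩ => ?_⟩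
  · refine hits_of_forall_gt (S.continuous_noise ω ω) (hs.isFrontPath ω) fun u hu => ?_
    by_contra hno
    have h1 : (u : ℝ≥0∞) ≤ S.tau s y ω := by
      refine le_iInf₂ fun r hr => ?_
      by_contra! hlt
      exact hno ⟨r, by exact_mod_cast hlt.le, by rwa [hX] at hr⟩
    exact absurd (h1.trans h) (not_le.2 (by exact_mod_cast hu))
  · exact (iInf₂_le r (by rwa [hX])).trans (by exact_mod_cast hrt)

variable [IsProbabilityMeasure μ]

/-- The hitting probability with all data except the idiosyncratic noise frozen. -/
noncomputable def condHitProb (s : ℝ≥0 → Ω → ℝ) (t : ℝ≥0) (y : ℝ) (ω : Ω) : ℝ :=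
  hitProb μ (S.noise ω) (fun r => s r ω) t y

/-- The operator `Γ`, defined realisation by realisation of the initial data and of `W`. -/
noncomputable def gam (s : ℝ≥0 → Ω → ℝ) (t : ℝ≥0) (ω : Ω) : ℝ :=
  frontOp μ (S.noise ω) (S.nu0 ω) (S.s0 ω) (1 / (S.lam * S.kap)) (fun r => s r ω) t

omit [IsProbabilityMeasure μ] in
theorem coef_nonneg : 0 ≤ 1 / (S.lam * S.kap) := by
  have := S.lam_pos
  have := S.kap_pos
  positivity

variable {s : ℝ≥0 → Ω → ℝ} (hs : S.IsFront s)
include hs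

theorem measurable_condHitProb (t : ℝ≥0) (y : ℝ) : Measurable[S.filt t] (S.condHitProb s t y) := by
  have hw : ∀ r ≤ t, Measurable[S.filt t] (S.W' r) := fun _ h => S.measurable_filt_W' h
  have hf : ∀ r ≤ t, Measurable[S.filt t] (s r) := fun _ h => hs.measurable h
  have h1 := @measurable_hitProb_prod Ω _ μ _ Ω (S.filt t) S.B' S.W' s S.sig S.theta t
    S.measurable_B' S.continuous_B' hw S.continuous_W' hf hs.isFrontPath
  have h2 : @Measurable Ω (Ω × ℝ) (S.filt t) ((S.filt t).prod inferInstance) fun ω => (ω, y) :=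
    @measurable_prodMk_right Ω ℝ (S.filt t) _ y
  have h3 := h1.comp h2
  exact h3

theorem measurable_gam (t : ℝ≥0) : Measurable[S.filt t] (S.gam s t) := by
  have hw : ∀ r ≤ t, Measurable[S.filt t] (S.W' r) := fun _ h => S.measurable_filt_W' h
  have hf : ∀ r ≤ t, Measurable[S.filt t] (s r) := fun _ h => hs.measurable h
  exact @measurable_frontOp Ω _ μ _ Ω (S.filt t) S.B' S.W' s S.sig S.theta t S.measurable_B'
    S.continuous_B' hw S.continuous_W' hf hs.isFrontPath S.nu0 (S.measurable_filt_nu0 t)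
    S.finite_nu0 S.s0 (S.measurable_filt_s0 t) _

theorem isFront_gam : S.IsFront (S.gam s) where
  adapted := S.measurable_gam hs
  nonneg t ω := (S.s0_nonneg ω).trans (le_frontOp S.coef_nonneg _ t)
  mono ω := by
    have := S.finite_nu0 ω
    exact (isFrontPath_frontOp (S.continuous_noise ω) (S.measurable_noise ω) S.coef_nonneg
      (hs.isFrontPath ω)).mono
  rightCont ω := by
    have := S.finite_nu0 ω
    exact (isFrontPath_frontOp (S.continuous_noise ω) (S.measurable_noise ω) S.coef_nonneg
      (hs.isFrontPath ω)).rightCont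

omit [IsProbabilityMeasure μ] in
theorem tau_le_ae_eq (t : ℝ≥0) (y : ℝ) : {ω | S.tau s y ω ≤ t} =ᵐ[μ]
    {ω | Hits (fun r => S.noise ω r ω) (fun r => s r ω) t y} := by
  filter_upwards [S.ae_notMem_badSet] with ω hω
  exact propext (S.tau_le_iff hs hω y t)

/-- As the idiosyncratic noise is independent of `F_∞`, the conditional hitting probability is
computed by freezing everything else. -/
theorem condHitProb_ae_eq_filtInfty (t : ℝ≥0) (y : ℝ) :
    S.condHitProb s t y =ᵐ[μ] μ⟦{ω | S.tau s y ω ≤ t}|S.filtInfty⟧ := by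
  have hset : @MeasurableSet (Ω × Ω) (S.filtInfty.prod S.idioSigma)
      {q | Hits (fun r => S.noise q.1 r q.2) (fun r => s r q.1) t y} := by
    refine @measurableSet_hits (Ω × Ω) (S.filtInfty.prod S.idioSigma)
      (fun r q => S.noise q.1 r q.2) (fun r q => s r q.1) t (fun _ => y)
      (fun q => S.continuous_noise _ _) (fun q => hs.isFrontPath _) (fun r hr => ?_)
      (fun r hr => ?_) measurable_const
    · refine Measurable.add (Measurable.const_mul ?_ _) (Measurable.const_mul ?_ _)
      · exact (S.measurable_idioSigma_B' r).comp (@measurable_snd Ω Ω S.filtInfty S.idioSigma)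
      · exact ((S.measurable_filt_W' hr).mono (S.filt_le_filtInfty t) le_rfl).comp
          (@measurable_fst Ω Ω S.filtInfty S.idioSigma)
    · exact ((hs.measurable hr).mono (S.filt_le_filtInfty t) le_rfl).comp
          (@measurable_fst Ω Ω S.filtInfty S.idioSigma)
  have hind : @IndepFun Ω Ω Ω _ S.filtInfty S.idioSigma id id μ := by
    have h : Indep (S.filtInfty.comap id) (S.idioSigma.comap id) μ := by
      rw [MeasurableSpace.comap_id, MeasurableSpace.comap_id]
      exact S.indep_filtInfty_idioSigma
    exact h
  have h1 := @measureReal_ae_eq_condExp_comap Ω _ μ _ Ω Ω S.filtInfty S.idioSigma id id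
    (measurable_id'' S.filtInfty_le_measurableSpace) (measurable_id'' S.idioSigma_le) hind _ hset
  rw [MeasurableSpace.comap_id] at h1
  refine h1.trans (condExp_congr_ae ?_)
  exact indicator_ae_eq_of_ae_eq_set (S.tau_le_ae_eq hs t y).symm

theorem condHitProb_ae_eq_filt (t : ℝ≥0) (y : ℝ) :
    S.condHitProb s t y =ᵐ[μ] μ⟦{ω | S.tau s y ω ≤ t}|S.filt t⟧ := by
  have h1 := condExp_condExp_of_le (f := {ω | S.tau s y ω ≤ t}.indicator fun _ => (1 : ℝ)) (μ := μ)
    (S.filt_le_filtInfty t) S.filtInfty_le_measurableSpace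
  have h2 := condExp_congr_ae (m := S.filt t) (S.condHitProb_ae_eq_filtInfty hs t y)
  have h3 : Integrable (S.condHitProb s t y) μ :=
    integrable_condExp.congr (S.condHitProb_ae_eq_filtInfty hs t y).symm
  rw [condExp_of_stronglyMeasurable (S.filt.le t)
    (S.measurable_condHitProb hs t y).stronglyMeasurable h3] at h2
  exact h2.trans h1

theorem isCondProbVersion {t : ℝ≥0} (hm : S.filt t ≤ m)
    (h : ∀ y, S.condHitProb s t y =ᵐ[μ] μ⟦{ω | S.tau s y ω ≤ t}|m⟧) :
    IsCondProbVersion m μ (fun y => {ω | S.tau s y ω ≤ t}) (S.condHitProb s t) where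
  measurable y := (S.measurable_condHitProb hs t y).mono hm le_rfl
  ae_eq := h
  mem_Icc _ _ := ⟨hitProb_nonneg _ _ _, hitProb_le_one _ _ _⟩
  antitone _ := hitProb_antitone _ _
  leftCont ω := continuousWithinAt_hitProb (S.continuous_noise ω) (S.measurable_noise ω)
    (hs.isFrontPath ω) t

theorem isFrontAverage_iff {t : ℝ≥0} (hm : S.filt t ≤ m)
    (h : ∀ y, S.condHitProb s t y =ᵐ[μ] μ⟦{ω | S.tau s y ω ≤ t}|m⟧) {g : Ω → ℝ} :
    IsFrontAverage m S s t g ↔ g =ᵐ[μ] S.gam s t := by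
  have hv := S.isCondProbVersion hs hm h
  refine ⟨fun ⟨p, hp, hg⟩ => ?_, fun hg => ⟨_, hv, hg⟩⟩
  filter_upwards [hg, hp.ae_eq_all hv] with ω h1 h2
  simp_rw [h1, h2]
  rfl

omit hs [IsProbabilityMeasure μ] in
/-- For processes with front paths, almost sure equality at each time is indistinguishability. -/
theorem ae_forall_eq {s g : ℝ≥0 → Ω → ℝ} (hs : S.IsFront s) (hg : S.IsFront g)
    (h : ∀ t, s t =ᵐ[μ] g t) : ∀ᵐ ω ∂μ, ∀ t, s t ω = g t ω := by
  obtain ⟨D, hDc, hDd⟩ := TopologicalSpace.exists_countable_dense ℝ≥0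
  have h' : ∀ᵐ ω ∂μ, ∀ t ∈ D, s t ω = g t ω := (ae_ball_iff hDc).2 fun t _ => h t
  filter_upwards [h'] with ω hω t
  have hlim : ∀ {f : ℝ≥0 → Ω → ℝ}, S.IsFront f →
      Tendsto (fun r => f r ω) (𝓝[Ioi t ∩ D] t) (𝓝 (f t ω)) := fun hf =>
    (hf.rightCont ω t).mono_left (nhdsWithin_mono t fun z hz => mem_Ici.2 (le_of_lt hz.1))
  have : (𝓝[Ioi t ∩ D] t).NeBot := by
    rw [← mem_closure_iff_nhdsWithin_neBot]
    have hsub := closure_minimal (hDd.open_subset_closure_inter (isOpen_Ioi (a := t))) isClosed_closure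
    exact hsub (by rw [closure_Ioi]; exact self_mem_Ici)
  refine tendsto_nhds_unique (hlim hs) ((hlim hg).congr' ?_)
  filter_upwards [self_mem_nhdsWithin] with r hr
  exact (hω r hr.2).symm

/-- A front is a solution if and only if almost every path is a fixed point of the frozen front
operator. -/
theorem isSolution_iff : S.IsSolution s ↔ ∀ᵐ ω ∂μ, ∀ t, s t ω = S.gam s t ω := by
  refine ⟨fun h => S.ae_forall_eq hs (S.isFront_gam hs) fun t =>
    (S.isFrontAverage_iff hs le_rfl (S.condHitProb_ae_eq_filt hs t)).1 (h.eq t), fun h =>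
    ⟨hs, fun t => (S.isFrontAverage_iff hs le_rfl (S.condHitProb_ae_eq_filt hs t)).2 ?_⟩⟩
  filter_upwards [h] with ω hω using hω t

theorem isGamma_gam : S.IsGamma s (S.gam s) :=
  ⟨S.isFront_gam hs, fun t => (S.isFrontAverage_iff hs (S.filt_le_filtInfty t)
    (S.condHitProb_ae_eq_filtInfty hs t)).2 (ae_eq_refl _)⟩

theorem IsGamma.ae_eq_gam {g : ℝ≥0 → Ω → ℝ} (h : S.IsGamma s g) :
    ∀ᵐ ω ∂μ, ∀ t, g t ω = S.gam s t ω :=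
  S.ae_forall_eq h.isFront (S.isFront_gam hs) fun t =>
    (S.isFrontAverage_iff hs (S.filt_le_filtInfty t)
      (S.condHitProb_ae_eq_filtInfty hs t)).1 (h.eq t)

end Gamma
/-! ### The minimal solution -/

section Minimal

variable {Ω : Type*} [MeasurableSpace Ω] {μ : Measure Ω} (S : Setting Ω μ)

/-- The iterates of `Γ` started from `0`, realisation by realisation. -/
noncomputable def iter (n : ℕ) (t : ℝ≥0) (ω : Ω) : ℝ :=
  frontIter μ (S.noise ω) (S.nu0 ω) (S.s0 ω) (1 / (S.lam * S.kap)) n t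

/-- The candidate for the minimal solution: the least front, realisation by realisation. -/
noncomputable def minProc (t : ℝ≥0) (ω : Ω) : ℝ :=
  minFront μ (S.noise ω) (S.nu0 ω) (S.s0 ω) (1 / (S.lam * S.kap)) t

variable [IsProbabilityMeasure μ]

theorem isFront_iter (n : ℕ) : S.IsFront (S.iter n) := by
  induction n with
  | zero => exact ⟨fun _ => measurable_const, fun _ _ => le_rfl, fun _ _ _ _ => le_rfl,
      fun _ _ => continuousWithinAt_const⟩
  | succ n ih => exact S.isFront_gam ih

theorem isGammaIterates_iter : S.IsGammaIterates S.iter :=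
  ⟨rfl, fun n => S.isGamma_gam (S.isFront_iter n)⟩

/-- The iterates of `Γ` are unique up to indistinguishability. -/
theorem IsGammaIterates.ae_eq_iter {S : Setting Ω μ} {g : ℕ → ℝ≥0 → Ω → ℝ}
    (hg : S.IsGammaIterates g) : ∀ᵐ ω ∂μ, ∀ n t, g n t ω = S.iter n t ω := by
  rw [ae_all_iff]
  intro n
  induction n with
  | zero => exact ae_of_all _ fun ω t => by rw [hg.zero]; rfl
  | succ n ih =>
    have hfront : S.IsFront (g n) := by
      cases n with
      | zero => rw [hg.zero]; exact S.isFront_iter 0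
      | succ n => exact (hg.succ n).isFront
    filter_upwards [ih, (hg.succ n).ae_eq_gam S hfront] with ω h1 h2 t
    rw [h2 t, gam, funext h1]
    rfl

theorem measurable_frontLim (t : ℝ≥0) : Measurable[S.filt t] fun ω =>
    frontLim μ (S.noise ω) (S.nu0 ω) (S.s0 ω) (1 / (S.lam * S.kap)) t :=
  Measurable.iSup fun n => (S.isFront_iter n).adapted t

theorem isFrontPath_minProc (ω : Ω) : IsFrontPath fun t => S.minProc t ω := by
  have := S.finite_nu0 ω
  exact isFrontPath_minFront (S.s0_nonneg ω) S.coef_nonneg (S.continuous_noise ω)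
    (S.measurable_noise ω)

theorem isFront_minProc : S.IsFront S.minProc where
  nonneg t ω := by
    have := S.finite_nu0 ω
    exact (S.s0_nonneg ω).trans (le_minFront (S.s0_nonneg ω) S.coef_nonneg
      (S.continuous_noise ω) (S.measurable_noise ω) t)
  mono ω := (S.isFrontPath_minProc ω).mono
  rightCont ω := (S.isFrontPath_minProc ω).rightCont
  adapted t := by
    -- As a right limit, the least front is adapted because the filtration is right-continuous.
    have key : ∀ u > t, Measurable[S.rawFilt u] (S.minProc t) := by
      intro u hu
      obtain ⟨v, -, hv, hvt⟩ := exists_seq_strictAnti_tendsto' (show t < u from hu)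
      refine @measurable_of_tendsto_metrizable Ω ℝ (S.rawFilt u) _ _ _ _
        (fun k ω => frontLim μ (S.noise ω) (S.nu0 ω) (S.s0 ω) (1 / (S.lam * S.kap)) (v k)) _
        (fun k => (S.measurable_frontLim (v k)).mono (S.filt_le_rawFilt (hv k).2) le_rfl)
        (tendsto_pi_nhds.2 fun ω => ?_)
      have := S.finite_nu0 ω
      exact (tendsto_frontLim (S.s0_nonneg ω) S.coef_nonneg (S.continuous_noise ω)
        (S.measurable_noise ω) t).comp (tendsto_nhdsWithin_iff.2
          ⟨hvt, Eventually.of_forall fun k => (hv k).1⟩)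
    intro A hA
    change MeasurableSet[S.rawFilt.rightCont t] _
    rw [Filtration.rightCont_eq]
    simp only [MeasurableSpace.measurableSet_iInf]
    exact fun u hu => key u hu hA

theorem isSolution_minProc : S.IsSolution S.minProc := by
  rw [S.isSolution_iff S.isFront_minProc]
  filter_upwards [ae_measure_forall_nonneg_eq_zero S.isPreBrownianReal_B' S.measurable_B'
    S.isPreBrownianReal_W' S.measurable_W' S.sig_ne_zero S.theta] with ω hω t
  have := S.finite_nu0 ω
  refine (frontOp_minFront (S.s0_nonneg ω) S.coef_nonneg (S.continuous_noise ω)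
    (S.measurable_noise ω) (fun t ht y => ?_) t).symm
  exact measure_hits_not_crosses (w := fun r => S.theta * S.W' r ω) S.isPreBrownianReal_B'
    S.measurable_B' S.continuous_B' S.sig_ne_zero ((S.continuous_W' ω).const_mul _)
    (S.isFrontPath_minProc ω) (S.noise_zero ω) hω ht y

theorem isMinimalSolution_minProc : S.IsMinimalSolution S.minProc where
  isSolution := S.isSolution_minProc
  le s' hs' := by
    filter_upwards [(S.isSolution_iff hs'.isFront).1 hs'] with ω hω
    have := S.finite_nu0 ω
    exact minFront_le (S.s0_nonneg ω) S.coef_nonneg (S.continuous_noise ω) (S.measurable_noise ω)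
      (hs'.isFront.isFrontPath ω) (fun t => hs'.isFront.nonneg t ω) fun t => (hω t).ge

theorem IsMinimalSolution.ae_eq_minProc {S : Setting Ω μ} {s : ℝ≥0 → Ω → ℝ}
    (hs : S.IsMinimalSolution s) : ∀ᵐ ω ∂μ, ∀ t, s t ω = S.minProc t ω := by
  filter_upwards [hs.le _ S.isSolution_minProc,
    S.isMinimalSolution_minProc.le _ hs.isSolution] with ω h1 h2 t
  exact le_antisymm (h1 t) (h2 t)

theorem InitialAligned.ae_minProc_zero {S : Setting Ω μ} (h : S.InitialAligned) :
    ∀ᵐ ω ∂μ, S.minProc 0 ω = S.s0 ω := by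
  filter_upwards [h] with ω hω
  have := S.finite_nu0 ω
  exact minFront_zero (S.s0_nonneg ω) S.coef_nonneg (S.continuous_noise ω) (S.measurable_noise ω)
    (S.noise_zero ω) hω

theorem tendsto_iter {ω : Ω} {t : ℝ≥0} (ht : 0 < t)
    (hcont : ContinuousAt (fun r => S.minProc r ω) t) :
    Tendsto (fun n => S.iter n t ω) atTop (𝓝 (S.minProc t ω)) := by
  have := S.finite_nu0 ω
  exact tendsto_frontIter_of_continuousAt (S.s0_nonneg ω) S.coef_nonneg (S.continuous_noise ω)
    (S.measurable_noise ω) ht hcont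

/-- If the front does not jump at time `0`, then the iterates also converge there: from the first one
on they lie between `s₀` and the minimal solution. -/
theorem tendsto_iter_zero {ω : Ω} (h : S.minProc 0 ω = S.s0 ω) :
    Tendsto (fun n => S.iter n 0 ω) atTop (𝓝 (S.minProc 0 ω)) := by
  have := S.finite_nu0 ω
  refine (tendsto_add_atTop_iff_nat 1).1 (tendsto_const_nhds.congr fun n => le_antisymm ?_ ?_)
  · rw [h]
    exact le_frontOp S.coef_nonneg _ 0
  · exact frontIter_le_minFront (S.s0_nonneg ω) S.coef_nonneg (S.continuous_noise ω)
      (S.measurable_noise ω) (n + 1) 0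

end Minimal
end Setting
end StefanMV

theorem mainTheorem9 {Ω : Type*} [MeasurableSpace Ω] {μ : Measure Ω} [IsProbabilityMeasure μ]
    (S : StefanMV.Setting Ω μ) :
    (∃ s, S.IsMinimalSolution s) ∧ (∃ g, S.IsGammaIterates g) ∧
    ∀ s, S.IsMinimalSolution s →
      (S.InitialAligned → ∀ᵐ ω ∂μ, s 0 ω = S.s0 ω) ∧
      ∀ g, S.IsGammaIterates g →
        (∀ᵐ ω ∂μ, ∀ t : ℝ≥0, 0 < t → ContinuousAt (fun r => s r ω) t →
          Tendsto (fun n => g n t ω) atTop (𝓝 (s t ω))) ∧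
        (S.InitialAligned → ∀ᵐ ω ∂μ, Tendsto (fun n => g n 0 ω) atTop (𝓝 (s 0 ω))) := by
  refine ⟨⟨_, S.isMinimalSolution_minProc⟩, ⟨_, S.isGammaIterates_iter⟩, fun s hs =>
    ⟨fun hal => ?_, fun g hg => ⟨?_, fun hal => ?_⟩⟩⟩
  · filter_upwards [hs.ae_eq_minProc, hal.ae_minProc_zero] with ω h1 h2
    rw [h1, h2]
  · filter_upwards [hs.ae_eq_minProc, hg.ae_eq_iter] with ω h1 h2 t ht hcont
    simp only [h1] at hcont ⊢
    simp only [h2]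
    exact S.tendsto_iter ht hcont
  · filter_upwards [hs.ae_eq_minProc, hg.ae_eq_iter, hal.ae_minProc_zero] with ω h1 h2 h3
    simp only [h1, h2]
    exact S.tendsto_iter_zero h3
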